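/- Let $\Omega\subset\mathbb{R}^2$ be a bounded domain with Lipschitz boundary, let $X_0=L^2(\Omega)\times L^2(\Omega)$ and $X_1=H^1(\Omega)\times H^1(\Omega)$ with their Hilbert norms, and let $(X_1)'$ be the dual of $X_1$. Let $D:\mathbb{R}^2\to M_{2\times2}(\mathbb{R})$ satisfy, for some $\alpha,L,M>0$: (H1) $\xi^TD(s)\xi\ge\alpha|\xi|^2$ for all $s,\xi\in\mathbb{R}^2$; (H2) $|D_{ij}(r)-D_{ij}(s)|\le L|r-s|$ for all $r,s\in\mathbb{R}^2$ and all $i,j$; (H3) $|D_{ij}(s)|\le M$ for all $s\in\mathbb{R}^2$ and all $i,j$. For $\mathbf u_0\in X_0$, a weak solution with initial value $\mathbf u_0$ of the cross-diffusion problem $$\partial_t u_i=\operatorname{div}\bigl(D_{i1}(\mathbf u)\nabla u_1+D_{i2}(\mathbf u)\nabla u_2\bigr)\ \text{ in }\Omega,\qquad \langle D_{i1}(\mathbf u)\nabla u_1+D_{i2}(\mathbf u)\nabla u_2,\mathbf n\rangle=0\ \text{ on }\partial\Omega\qquad(i=1,2)$$ is a continuous $\mathbf u:[0,\infty)\to X_0$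 with $\mathbf u(0)=\mathbf u_0$ such that, for every $T>0$, $\mathbf u\in L^2(0,T;X_1)$, its weak time derivative satisfies $\partial_t\mathbf u\in L^2(0,T;(X_1)')$, and for almost every $t\in(0,T)$ $$\langle\partial_t\mathbf u(t),\mathbf w\rangle+\int_\Omega\operatorname{tr}\bigl((J\mathbf w)^TD(\mathbf u(t))\,J\mathbf u(t)\bigr)\,dx=0\quad\text{for all }\mathbf w\in X_1,$$ where $J$ denotes the Jacobian matrix. Write $T_t(\mathbf u_0)=\mathbf u(t)$ (if uniqueness is not known, $T_t(\mathbf u_0)$ is the set of the values at time $t$ of all weak solutions with initial value $\mathbf u_0$, and the identities below are between sets). For $\mathbf u_0=(u_{0,1},u_{0,2})\in X_0$ let $\mathbf M(\mathbf u_0)\in\mathbb{R}^2$ be the vector of the averages $\frac1{|\Omega|}\int_\Omega u_{0,i}\,dx$. Assume the shift invariance $$T_t(\mathbf 0)=\mathbf 0,\qquad T_t(\mathbf v_0+\mathbf C)=T_t(\mathbf v_0)+\mathbf C\qquad\text{for all }t\ge0,\ \mathbf v_0\in X_1,\ \mathbf C\in\mathbb{R}^2.$$ Then, for every $\mathbf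 u_0\in X_0$ and every weak solution $\mathbf u$ with initial value $\mathbf u_0$, the function $\mathbf w(t)=\mathbf u(t)-\mathbf M(\mathbf u_0)$ satisfies $$\lim_{t\to\infty}\|\mathbf w(t)\|_{X_0}=0.$$ More precisely, there is a constant $C_0>0$ that depends only on $\Omega$ such that $\|\mathbf w(t)\|_{X_0}^2\le e^{-2\alpha C_0t}\|\mathbf w(0)\|_{X_0}^2$ for all $t\ge0$. -/

import Mathlib

open MeasureTheory Filter Topology Set
open scoped NNReal ContDiff Matrix

noncomputable section

namespace CrossDiffusion

/-- The Euclidean plane. -/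
abbrev Plane : Type := EuclideanSpace ℝ (Fin 2)

/-- `Ω` has a Lipschitz boundary: near each of its boundary points and in suitable orthonormal
coordinates, `Ω` is the strict epigraph of a Lipschitz function of one variable. -/
def HasLipschitzBoundary (Ω : Set Plane) : Prop :=
  ∀ x ∈ frontier Ω, ∃ (e : Plane ≃ₗᵢ[ℝ] Plane) (γ : ℝ → ℝ) (K : ℝ≥0), LipschitzWith K γ ∧
    ∀ᶠ y in 𝓝 x, (y ∈ Ω ↔ γ (e y 0) < e y 1)

/-- Bounded domains (nonempty connected open sets) of the plane with Lipschitz boundary. -/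
structure Domain where
  carrier : Set Plane
  isOpen : IsOpen carrier
  isConnected : IsConnected carrier
  isBounded : Bornology.IsBounded carrier
  hasLipschitzBoundary : HasLipschitzBoundary carrier

namespace Domain

/-- Lebesgue measure on the domain. -/
abbrev measure (Ω : Domain) : Measure Plane := volume.restrict Ω.carrier

instance (Ω : Domain) : IsFiniteMeasure Ω.measure :=
  isFiniteMeasure_restrict.2 Ω.isBounded.measure_lt_top.ne

end Domain

/-- The Lebesgue space `L²(Ω)`. -/
abbrev L2 (Ω : Domain) : Type := Lp ℝ 2 Ω.measure

/-- `g` is the weak partial derivative of `f` in the `j`-th coordinate direction. -/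
def IsWeakPartial (Ω : Domain) (j : Fin 2) (f g : L2 Ω) : Prop :=
  ∀ φ : Plane → ℝ, ContDiff ℝ ∞ φ → HasCompactSupport φ → tsupport φ ⊆ Ω.carrier →
    ∫ x, f x * fderiv ℝ φ x (EuclideanSpace.single j 1) ∂Ω.measure =
      -∫ x, g x * φ x ∂Ω.measure

theorem integrable_mul_test {Ω : Domain} (f : L2 Ω) {ψ : Plane → ℝ} (hc : Continuous ψ)
    (hs : HasCompactSupport ψ) : Integrable (fun x => f x * ψ x) Ω.measure :=
  (Lp.memLp f).integrable_mul (q := 2) (hc.memLp_of_hasCompactSupport hs)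

theorem continuous_partial {φ : Plane → ℝ} (h : ContDiff ℝ ∞ φ) (v : Plane) :
    Continuous fun x => fderiv ℝ φ x v :=
  (h.continuous_fderiv (by simp)).clm_apply continuous_const

theorem hasCompactSupport_partial {φ : Plane → ℝ} (h : HasCompactSupport φ) (v : Plane) :
    HasCompactSupport fun x => fderiv ℝ φ x v :=
  h.fderiv_apply (𝕜 := ℝ) v

/-- The Sobolev space `H¹(Ω)` as a subspace: its elements are the tuples `(f, ∇f)` of an `L²` function and its
weak gradient, which is again in `L²`. It carries the Hilbert norm
`(‖f‖² + ‖∂₁f‖² + ‖∂₂f‖²)^(1/2)`. -/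
def sobolevSubmodule (Ω : Domain) : Submodule ℝ (WithLp 2 (L2 Ω × PiLp 2 fun _ : Fin 2 => L2 Ω)) where
  carrier := {p | ∀ j, IsWeakPartial Ω j p.fst (p.snd j)}
  zero_mem' := by
    intro j φ hφ hc hs
    have h1 : ∫ x, (0 : L2 Ω) x * fderiv ℝ φ x (EuclideanSpace.single j 1) ∂Ω.measure = 0 := by
      refine integral_eq_zero_of_ae ?_
      filter_upwards [Lp.coeFn_zero ℝ 2 Ω.measure] with x hx
      rw [hx, Pi.zero_apply, zero_mul]
    have h2 : ∫ x, (0 : L2 Ω) x * φ x ∂Ω.measure = 0 := by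
      refine integral_eq_zero_of_ae ?_
      filter_upwards [Lp.coeFn_zero ℝ 2 Ω.measure] with x hx
      rw [hx, Pi.zero_apply, zero_mul]
    exact h1.trans (by rw [← neg_zero]; exact congrArg Neg.neg h2.symm)
  add_mem' := by
    intro p q hp hq j φ hφ hc hs
    have key : ∀ (f g : L2 Ω) (ψ : Plane → ℝ), Continuous ψ → HasCompactSupport ψ →
        ∫ x, (f + g : L2 Ω) x * ψ x ∂Ω.measure =
          ∫ x, f x * ψ x ∂Ω.measure + ∫ x, g x * ψ x ∂Ω.measure := by
      intro f g ψ h1 h2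
      rw [← integral_add (integrable_mul_test f h1 h2) (integrable_mul_test g h1 h2)]
      refine integral_congr_ae ?_
      filter_upwards [Lp.coeFn_add f g] with x hx
      rw [hx, Pi.add_apply, add_mul]
    have e1 := key p.fst q.fst _ (continuous_partial hφ (EuclideanSpace.single j 1))
      (hasCompactSupport_partial hc (EuclideanSpace.single j 1))
    have e2 := key (p.snd j) (q.snd j) φ hφ.continuous hc
    have a := hp j φ hφ hc hs
    have b := hq j φ hφ hc hs
    simp only [WithLp.add_fst, WithLp.add_snd, PiLp.add_apply]
    rw [e1, e2, a, b, neg_add]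
  smul_mem' := by
    intro c p hp j φ hφ hc hs
    have key : ∀ (f : L2 Ω) (ψ : Plane → ℝ),
        ∫ x, (c • f : L2 Ω) x * ψ x ∂Ω.measure = c * ∫ x, f x * ψ x ∂Ω.measure := by
      intro f ψ
      rw [← integral_const_mul]
      refine integral_congr_ae ?_
      filter_upwards [Lp.coeFn_smul c f] with x hx
      rw [hx, Pi.smul_apply, smul_eq_mul, mul_assoc]
    have a := hp j φ hφ hc hs
    simp only [WithLp.smul_fst, WithLp.smul_snd, PiLp.smul_apply]
    rw [key, key, a, mul_neg]

/-- The Sobolev space `H¹(Ω)`, with its Hilbert space structure. -/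
def H1 (Ω : Domain) : Type := sobolevSubmodule Ω

namespace H1

instance (Ω : Domain) : NormedAddCommGroup (H1 Ω) :=
  inferInstanceAs (NormedAddCommGroup (sobolevSubmodule Ω))

instance (Ω : Domain) : InnerProductSpace ℝ (H1 Ω) :=
  inferInstanceAs (InnerProductSpace ℝ (sobolevSubmodule Ω))

/-- The underlying `L²` function. -/
def fn {Ω : Domain} (f : H1 Ω) : L2 Ω := f.1.fst

/-- The weak partial derivatives. -/
def grad {Ω : Domain} (f : H1 Ω) (j : Fin 2) : L2 Ω := f.1.snd j

end H1

/-- `X₀ = L²(Ω) × L²(Ω)`, with norm `(‖u‖² + ‖v‖²)^(1/2)`. -/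
abbrev X0 (Ω : Domain) : Type := PiLp 2 fun _ : Fin 2 => L2 Ω

/-- `X₁ = H¹(Ω) × H¹(Ω)`, with norm `(‖u‖² + ‖v‖²)^(1/2)`. -/
def X1 (Ω : Domain) : Type := PiLp 2 fun _ : Fin 2 => H1 Ω

namespace X1

instance (Ω : Domain) : NormedAddCommGroup (X1 Ω) :=
  inferInstanceAs (NormedAddCommGroup (PiLp 2 fun _ : Fin 2 => H1 Ω))

instance (Ω : Domain) : InnerProductSpace ℝ (X1 Ω) :=
  inferInstanceAs (InnerProductSpace ℝ (PiLp 2 fun _ : Fin 2 => H1 Ω))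

variable {Ω : Domain}

/-- The components `w₁`, `w₂` of `w`. -/
def comp (w : X1 Ω) (i : Fin 2) : H1 Ω := WithLp.ofLp (p := 2) (V := Fin 2 → H1 Ω) w i

/-- The inclusion of `X₁` in `X₀`. -/
def toX0 (w : X1 Ω) : X0 Ω := WithLp.toLp 2 fun i => (w.comp i).fn

/-- The value `w(x)`. -/
def val (w : X1 Ω) (x : Plane) : Plane := WithLp.toLp 2 fun i => (w.comp i).fn x

/-- The Jacobian matrix `Jw(x)`, with entries `∂ⱼwᵢ(x)`. -/
def jacobian (w : X1 Ω) (x : Plane) : Matrix (Fin 2) (Fin 2) ℝ :=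
  Matrix.of fun i j => (w.comp i).grad j x

end X1

/-- The standing hypotheses on the diffusion matrix: uniform positive definiteness with constant
`α`, Lipschitz continuity with constant `L`, and boundedness by `M`. -/
structure IsDiffusionMatrix (D : Plane → Matrix (Fin 2) (Fin 2) ℝ) (α L M : ℝ) : Prop where
  alpha_pos : 0 < α
  lip_pos : 0 < L
  bound_pos : 0 < M
  elliptic : ∀ (s : Plane) (ξ : Fin 2 → ℝ), α * (ξ ⬝ᵥ ξ) ≤ ξ ⬝ᵥ (D s *ᵥ ξ)
  lipschitz : ∀ (s r : Plane) (i j : Fin 2), |D r i j - D s i j| ≤ L * ‖r - s‖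
  bounded : ∀ (s : Plane) (i j : Fin 2), |D s i j| ≤ M

/-- `∫_Ω tr((Jw)ᵀ D(u) (Ju))`. -/
def diffusionForm {Ω : Domain} (D : Plane → Matrix (Fin 2) (Fin 2) ℝ) (u w : X1 Ω) : ℝ :=
  ∫ x, ((w.jacobian x)ᵀ * D (u.val x) * u.jacobian x).trace ∂Ω.measure

/-- `du`, a function with values in the dual of `X₁`, is the weak time derivative of `u` on
`(0, T)`, where an element of `X₀` acts on `X₁` by the inner product of `X₀`. -/
def IsWeakTimeDeriv {Ω : Domain} (T : ℝ) (u : ℝ → X0 Ω) (du : ℝ → StrongDual ℝ (X1 Ω)) : Prop :=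
  ∀ φ : ℝ → ℝ, ContDiff ℝ ∞ φ → HasCompactSupport φ → tsupport φ ⊆ Ioo 0 T →
    ∀ w : X1 Ω, ∫ t in Ioc 0 T, deriv φ t * inner ℝ (u t) w.toX0 =
      -∫ t in Ioc 0 T, φ t * du t w

/-- `u` is a weak solution, for all times, of the Neumann problem with diffusion matrix `D` and
initial value `u₀`: it is continuous from `[0, ∞)` to `X₀`, has the value `u₀` at time `0`, and on
each `(0, T]` it is in `L²(0, T, X₁)` (with `U` for its `X₁`-valued version), has a weak
time derivative `du` in `L²(0, T, X₁')`, and satisfies the weak form of the equation.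
Values at negative times play no role. -/
structure IsWeakSolution {Ω : Domain} (D : Plane → Matrix (Fin 2) (Fin 2) ℝ) (u₀ : X0 Ω)
    (u : ℝ → X0 Ω) : Prop where
  continuousOn : ContinuousOn u (Ici 0)
  initial : u 0 = u₀
  weak : ∀ T : ℝ, 0 < T → ∃ (U : ℝ → X1 Ω) (du : ℝ → StrongDual ℝ (X1 Ω)),
    MemLp U 2 (volume.restrict (Ioc 0 T)) ∧
    (∀ᵐ t ∂(volume.restrict (Ioc 0 T)), (U t).toX0 = u t) ∧
    MemLp du 2 (volume.restrict (Ioc 0 T)) ∧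
    IsWeakTimeDeriv T u du ∧
    ∀ᵐ t ∂(volume.restrict (Ioc 0 T)), ∀ w : X1 Ω, du t w + diffusionForm D (U t) w = 0

/-- The constant function `C`, as an element of `X₀`. -/
def constant (Ω : Domain) (C : Fin 2 → ℝ) : X0 Ω :=
  WithLp.toLp 2 fun i => Lp.const 2 Ω.measure (C i)

/-- The pair `M(u) = (m(u₁), m(u₂))` of averages over `Ω`. -/
def average {Ω : Domain} (u : X0 Ω) : Fin 2 → ℝ :=
  fun i => (volume Ω.carrier).toReal⁻¹ * ∫ x, u i x ∂Ω.measure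

/-- The scale-space operator `T_t`, as a possibly multivalued map: the set of the values at time
`t` of the weak solutions with initial value `u₀`. Where the solution exists and is unique, this
is the singleton of `T_t(u₀)`. -/
def scaleSpace {Ω : Domain} (D : Plane → Matrix (Fin 2) (Fin 2) ℝ) (t : ℝ) (u₀ : X0 Ω) :
    Set (X0 Ω) :=
  {z | ∃ u : ℝ → X0 Ω, IsWeakSolution D u₀ u ∧ u t = z}

/-- Grey-level shift invariance: `T_t(0) = 0` and `T_t(u₀ + C) = T_t(u₀) + C` for all `t ≥ 0`, all
`u₀` in `X₁` and all constant vectors `C`. -/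
def ShiftInvariant (Ω : Domain) (D : Plane → Matrix (Fin 2) (Fin 2) ℝ) : Prop :=
  ∀ t : ℝ, 0 ≤ t → scaleSpace D t (0 : X0 Ω) = {0} ∧
    ∀ (u₀ : X1 Ω) (C : Fin 2 → ℝ),
      scaleSpace D t (u₀.toX0 + constant Ω C) =
        (fun z => z + constant Ω C) '' scaleSpace D t u₀.toX0

end CrossDiffusion

end

/-!
Test the equation with `u(t) - M(u₀)`. Since the Jacobian does not see constants, ellipticity of `D`
gives `d/dt ‖u - M(u₀)‖² ≤ -2α ‖Ju‖²`. Testing with constants shows that the mass is conserved, so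
`u(t) - M(u₀)` has mean value zero for every `t` and the Poincaré inequality
`C₀ ‖f‖² ≤ ‖∇f‖²` (`exists_poincare_constant`) turns this into
`d/dt ‖u - M(u₀)‖² ≤ -2αC₀ ‖u - M(u₀)‖²`; Grönwall's inequality concludes. The constant `C₀` is that
of the Poincaré inequality, hence depends on `Ω` only.

Two ingredients have to be built.

* The energy identity `‖v(b)‖² - ‖v(a)‖² = 2 ∫ ⟨∂ₜv, v⟩` (`energy_identity`) for
  `v ∈ L²(0, T; X₁)` with `∂ₜv ∈ L²(0, T; X₁')`. By `sub_eq_integral_of_weak_deriv` the increments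
  of `v`, tested with a fixed element of `X₁`, are the integrals of `∂ₜv`. Hence
  `‖v(s + h)‖² - ‖v(s)‖² = ∫₀ʰ ⟨∂ₜv(s + τ), v(s) + v(s + h)⟩ dτ` for almost every `s`. Integrate
  over `s`, divide by `h` and let `h → 0`, using that translations are strongly continuous on `L²(ℝ)`.

* The Poincaré inequality. Call `A ⊆ Ω` a Poincaré set if the oscillation of `f` on `A` is
  controlled by `∇f` on all of `Ω`. For a disc `B`, the set of the points that see all of `B` inside
  `Ω` is such a set (`isPoincareSet_visibleSet`): for smooth functions, integrate the gradient along
  the segments that join its points to those of `B`; mollification and Fatou's lemma do the rest.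
  Every point of the closure of `Ω` has a neighbourhood whose intersection with `Ω` lies in such a
  set; at the boundary, the disc is placed above the Lipschitz graph, at a height that is large
  compared with its radius. Overlapping Poincaré sets can be joined, so that connectedness and
  compactness give the inequality on `Ω` (`isPoincareSet_carrier`).
-/

open scoped ENNReal Convolution

namespace CrossDiffusion

/-! ### The energy identity -/

/-- Translation of functions is strongly continuous on `L²(ℝ)`. -/
theorem continuous_toLp_translate {E : Type*} [NormedAddCommGroup E] {f : ℝ → E}
    (hf : MemLp f 2 (volume : Measure ℝ)) :
    Continuous fun τ : ℝ => Lp.compMeasurePreserving (· + τ)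
      (measurePreserving_add_right volume τ) (hf.toLp f) := by
  let g : C(ℝ, C(ℝ, ℝ)) :=
    (ContinuousMap.mk (fun a : ℝ × ℝ => a.2 + a.1) (by fun_prop)).curry
  exact (continuous_const (y := hf.toLp f)).compMeasurePreservingLp g.continuous
    (fun τ => measurePreserving_add_right volume τ) (by simp)

section Pairing

variable {E : Type*} [NormedAddCommGroup E] [NormedSpace ℝ E]
  {F : ℝ → StrongDual ℝ E} {V : ℝ → E}

/-- The pairing in `L²` of a translate of `F` with the sum of `V` and a translate of `V` depends
continuously on both translations. -/
theorem continuous_integral_translate (hF : MemLp F 2 (volume : Measure ℝ))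
    (hV : MemLp V 2 (volume : Measure ℝ)) (S : Set ℝ) :
    Continuous fun p : ℝ × ℝ => ∫ s in S, F (s + p.1) (V s + V (s + p.2)) := by
  let B : StrongDual ℝ E →L[ℝ] E →L[ℝ] ℝ := ContinuousLinearMap.id ℝ _
  let RF := LpToLpRestrictCLM ℝ (StrongDual ℝ E) ℝ volume 2 S
  let RV := LpToLpRestrictCLM ℝ E ℝ volume 2 S
  let tF := fun τ : ℝ => Lp.compMeasurePreserving (· + τ)
      (measurePreserving_add_right volume τ) (hF.toLp F)
  let tV := fun τ : ℝ => Lp.compMeasurePreserving (· + τ)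
      (measurePreserving_add_right volume τ) (hV.toLp V)
  have hc : Continuous fun p : ℝ × ℝ =>
      B.lpPairing (volume.restrict S) 2 2 (RF (tF p.1)) (RV (hV.toLp V + tV p.2)) := by
    have h1 : Continuous fun p : ℝ × ℝ => RF (tF p.1) :=
      RF.continuous.comp ((continuous_toLp_translate hF).comp continuous_fst)
    have h2 : Continuous fun p : ℝ × ℝ => RV (hV.toLp V + tV p.2) :=
      RV.continuous.comp
        (continuous_const.add ((continuous_toLp_translate hV).comp continuous_snd))
    exact ((B.lpPairing (volume.restrict S) 2 2).continuous.comp h1).clm_apply h2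
  refine hc.congr fun p => ?_
  rw [ContinuousLinearMap.lpPairing_eq_integral]
  refine integral_congr_ae ?_
  filter_upwards [LpToLpRestrictCLM_coeFn ℝ S (tF p.1),
    LpToLpRestrictCLM_coeFn ℝ S (hV.toLp V + tV p.2),
    ae_restrict_of_ae (Lp.coeFn_add (hV.toLp V) (tV p.2)),
    ae_restrict_of_ae hV.coeFn_toLp,
    ae_restrict_of_ae (Lp.coeFn_compMeasurePreserving (hF.toLp F)
      (measurePreserving_add_right volume p.1)),
    ae_restrict_of_ae (Lp.coeFn_compMeasurePreserving (hV.toLp V)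
      (measurePreserving_add_right volume p.2)),
    ae_restrict_of_ae ((measurePreserving_add_right volume p.1).quasiMeasurePreserving.ae
      hF.coeFn_toLp),
    ae_restrict_of_ae ((measurePreserving_add_right volume p.2).quasiMeasurePreserving.ae
      hV.coeFn_toLp)] with s h1 h2 h3 h4 h5 h6 h7 h8
  change (RF (tF p.1) s) (RV (hV.toLp V + tV p.2) s) = _
  rw [h1, h2, h3, Pi.add_apply, h4]
  change (Lp.compMeasurePreserving _ _ (hF.toLp F)) s
    (V s + (Lp.compMeasurePreserving _ _ (hV.toLp V)) s) = _
  rw [h5, h6, Function.comp_apply, Function.comp_apply, h7, h8]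

theorem integrable_pairing {μ : Measure ℝ} (hF : MemLp F 2 μ) (hV : MemLp V 2 μ) :
    Integrable (fun s => F s (V s)) μ :=
  memLp_one_iff_integrable.1
    ((ContinuousLinearMap.id ℝ (StrongDual ℝ E)).memLp_of_bilin (p := 2) (q := 2) 1 hF hV)

theorem _root_.MeasureTheory.MemLp.translate {G : Type*} [NormedAddCommGroup G] {f : ℝ → G}
    (hf : MemLp f 2 (volume : Measure ℝ)) (τ : ℝ) : MemLp (fun s => f (s + τ)) 2 volume :=
  hf.comp_measurePreserving (measurePreserving_add_right volume τ)

/-- Fubini's theorem for the pairing of the translates of `F` with a fixed function. -/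
theorem integrable_prod_translate (hF : MemLp F 2 (volume : Measure ℝ))
    (hV : MemLp V 2 (volume : Measure ℝ)) (S : Set ℝ) (h : ℝ) :
    Integrable (Function.uncurry fun (τ s : ℝ) => F (s + τ) (V s))
      ((volume.restrict (uIoc 0 h)).prod (volume.restrict S)) := by
  have hm : AEStronglyMeasurable (Function.uncurry fun (τ s : ℝ) => F (s + τ) (V s))
      ((volume.restrict (uIoc 0 h)).prod (volume.restrict S)) := by
    rw [Measure.prod_restrict]
    refine AEStronglyMeasurable.restrict ?_
    have h1 : AEStronglyMeasurable (fun p : ℝ × ℝ => F (p.2 + p.1)) (volume.prod volume) := by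
      have := hF.1.comp_quasiMeasurePreserving (quasiMeasurePreserving_add volume volume)
      simpa only [Function.comp_def, add_comm] using this
    have h2 : AEStronglyMeasurable (fun p : ℝ × ℝ => V p.2) (volume.prod volume) :=
      hV.1.comp_snd
    exact (ContinuousLinearMap.id ℝ (StrongDual ℝ E)).aestronglyMeasurable_comp₂ h1 h2
  have hF2 : Integrable (fun s => ‖F s‖ ^ 2) volume := hF.integrable_norm_pow two_ne_zero
  have hV2 : Integrable (fun s => ‖V s‖ ^ 2) volume := hV.integrable_norm_pow two_ne_zero
  rw [integrable_prod_iff hm]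
  constructor
  · exact Eventually.of_forall fun τ => (integrable_pairing (hF.translate τ) hV).restrict
  · have : IsFiniteMeasure (volume.restrict (uIoc 0 h)) := by
      rw [uIoc]; infer_instance
    refine Integrable.of_bound hm.norm.integral_prod_right'
      (∫ s, (‖F s‖ ^ 2 + ‖V s‖ ^ 2)) (Eventually.of_forall fun τ => ?_)
    have hFτ : Integrable (fun s => ‖F (s + τ)‖ ^ 2) volume := hF2.comp_add_right τ
    rw [Real.norm_of_nonneg (integral_nonneg fun _ => norm_nonneg _)]
    calc ∫ s in S, ‖F (s + τ) (V s)‖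
        ≤ ∫ s, ‖F (s + τ) (V s)‖ :=
          setIntegral_le_integral (integrable_pairing (hF.translate τ) hV).norm
            (Eventually.of_forall fun _ => norm_nonneg _)
      _ ≤ ∫ s, (‖F (s + τ)‖ ^ 2 + ‖V s‖ ^ 2) := by
          refine integral_mono (integrable_pairing (hF.translate τ) hV).norm (hFτ.add hV2)
            fun s => ?_
          -- `2xy ≤ x² + y²` gives a bound that does not depend on the translation `τ`
          have h1 := (F (s + τ)).le_opNorm (V s)
          simp only
          nlinarith [sq_nonneg (‖F (s + τ)‖ - ‖V s‖), sq_nonneg (‖F (s + τ)‖), sq_nonneg ‖V s‖]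
      _ = ∫ s, (‖F s‖ ^ 2 + ‖V s‖ ^ 2) := by
          rw [integral_add hFτ hV2, integral_add hF2 hV2,
            integral_add_right_eq_self (fun s => ‖F s‖ ^ 2)]

end Pairing

/-- The averaged difference quotients of a continuous function converge to its increment. -/
theorem tendsto_average_increment {N : ℝ → ℝ} (hNc : Continuous N) (a b : ℝ) :
    Tendsto (fun h : ℝ => h⁻¹ * ∫ s in a..b, (N (s + h) - N s)) (𝓝[>] 0) (𝓝 (N b - N a)) := by
  have hd : ∀ c : ℝ, Tendsto (fun h : ℝ => h⁻¹ * ∫ s in c..c + h, N s) (𝓝[>] 0) (𝓝 (N c)) := by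
    intro c
    have := (hNc.integral_hasStrictDerivAt c c).hasDerivAt.tendsto_slope_zero_right
    simpa using this
  refine ((hd b).sub (hd a)).congr fun h => ?_
  have hi : ∀ x y : ℝ, IntervalIntegrable N volume x y := fun x y => hNc.intervalIntegrable x y
  have hNh : IntervalIntegrable (fun s => N (s + h)) volume a b :=
    (hNc.comp (continuous_add_const h)).intervalIntegrable a b
  rw [← mul_sub, intervalIntegral.integral_sub hNh (hi a b),
    intervalIntegral.integral_comp_add_right,
    intervalIntegral.integral_interval_sub_interval_comm (hi _ _) (hi _ _) (hi _ _)]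
  congr 1
  rw [intervalIntegral.integral_symm a b, intervalIntegral.integral_symm (a + h) (b + h)]
  ring

theorem tendsto_average_diagonal {G : ℝ × ℝ → ℝ} (hGc : Continuous G) :
    Tendsto (fun h : ℝ => h⁻¹ * ∫ τ in (0 : ℝ)..h, G (τ, h)) (𝓝[>] 0) (𝓝 (G (0, 0))) := by
  rw [Metric.tendsto_nhdsWithin_nhds]
  intro ε hε
  obtain ⟨δ, hδ, hδ'⟩ := Metric.continuous_iff.1 hGc (0, 0) (ε / 2) (by positivity)
  refine ⟨δ, hδ, fun {h} hh hd => ?_⟩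
  have hh0 : (0 : ℝ) < h := hh
  have hhd : h < δ := by simpa [abs_of_pos hh0] using hd
  have hGi : IntervalIntegrable (fun τ => G (τ, h)) volume 0 h :=
    (hGc.comp (by fun_prop : Continuous fun τ : ℝ => (τ, h))).intervalIntegrable _ _
  have hb' : ‖∫ τ in (0 : ℝ)..h, (G (τ, h) - G (0, 0))‖ ≤ ε / 2 * |h - 0| := by
    refine intervalIntegral.norm_integral_le_of_norm_le_const fun τ hτ => ?_
    rw [uIoc_of_le hh0.le] at hτ
    refine (hδ' (τ, h) ?_).le
    rw [Prod.dist_eq, max_lt_iff]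
    constructor
    · rw [Real.dist_eq, sub_zero, abs_of_pos hτ.1]; exact hτ.2.trans_lt hhd
    · rw [Real.dist_eq, sub_zero, abs_of_pos hh0]; exact hhd
  rw [intervalIntegral.integral_sub hGi (by simp), intervalIntegral.integral_const, sub_zero,
    smul_eq_mul, abs_of_pos hh0] at hb'
  rw [Real.dist_eq]
  have e : h⁻¹ * (∫ τ in (0 : ℝ)..h, G (τ, h)) - G (0, 0) =
      h⁻¹ * ((∫ τ in (0 : ℝ)..h, G (τ, h)) - h * G (0, 0)) := by field_simp
  rw [e, abs_mul, abs_of_pos (inv_pos.2 hh0)]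
  calc h⁻¹ * |(∫ τ in (0 : ℝ)..h, G (τ, h)) - h * G (0, 0)| ≤ h⁻¹ * (ε / 2 * h) := by
        gcongr; exact hb'
    _ = ε / 2 := by field_simp
    _ < ε := by linarith

/-- Extension by zero from `(0, T]`, which allows translating the functions. -/
theorem exists_memLp_extension {G : Type*} [NormedAddCommGroup G] {T : ℝ} {f : ℝ → G}
    (hf : MemLp f 2 (volume.restrict (Ioc 0 T))) :
    ∃ g : ℝ → G, MemLp g 2 volume ∧ ∀ t, 0 < t → t ≤ T → g t = f t :=
  ⟨(Ioc 0 T).indicator f, (memLp_indicator_iff_restrict measurableSet_Ioc).2 hf,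
    fun _ h1 h2 => indicator_of_mem (mem_Ioc.2 ⟨h1, h2⟩) f⟩

section Energy

variable {E H : Type*} [NormedAddCommGroup E] [NormedSpace ℝ E]
  [NormedAddCommGroup H] [InnerProductSpace ℝ H] {ι : E →ₗ[ℝ] H} {T : ℝ}
  {v : ℝ → H} {V : ℝ → E} {F : ℝ → StrongDual ℝ E}

/-- The increments of `‖v‖²` over a time step `h`, integrated over the starting time: the increment
of `v` is tested with `v(s) + v(s + h)`, which lies in the range of `ι` for almost every `s`. -/
theorem integral_increment_norm_sq (hV : MemLp V 2 (volume : Measure ℝ))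
    (hF : MemLp F 2 (volume : Measure ℝ))
    (hιV : ∀ᵐ t, 0 < t → t ≤ T → ι (V t) = v t)
    (hder : ∀ (w : E) (s t : ℝ), 0 < s → s ≤ t → t < T →
      inner ℝ (v t - v s) (ι w) = ∫ r in s..t, F r w)
    {a b h : ℝ} (ha : 0 ≤ a) (hab : a ≤ b) (hh : 0 < h) (hb : b + h < T) :
    ∫ s in a..b, (‖v (s + h)‖ ^ 2 - ‖v s‖ ^ 2) =
      ∫ τ in (0 : ℝ)..h, ∫ s in Ioc a b, F (s + τ) (V s + V (s + h)) := by
  have hW : MemLp (fun s => V s + V (s + h)) 2 volume := hV.add (hV.translate h)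
  rw [intervalIntegral_integral_swap (integrable_prod_translate hF hW (Ioc a b) h),
    intervalIntegral.integral_of_le hab]
  refine setIntegral_congr_ae measurableSet_Ioc ?_
  filter_upwards [hιV, (measurePreserving_add_right volume h).quasiMeasurePreserving.ae hιV]
    with s h1 h2 hs
  have hs0 : 0 < s := ha.trans_lt hs.1
  have hsb : s ≤ b := hs.2
  have e1 := h1 hs0 (by linarith)
  have e2 := h2 (by linarith) (by linarith)
  have e3 : ‖v (s + h)‖ ^ 2 - ‖v s‖ ^ 2 = inner ℝ (v (s + h) - v s) (ι (V s + V (s + h))) := by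
    rw [map_add, e1, e2, inner_sub_left, inner_add_right, inner_add_right,
      real_inner_self_eq_norm_sq, real_inner_self_eq_norm_sq, real_inner_comm (v s)]
    ring
  rw [e3, hder _ s (s + h) hs0 (by linarith) (by linarith),
    intervalIntegral.integral_comp_add_left (fun r => F r (V s + V (s + h))) s, add_zero]

/-- The energy identity `d/dt ‖v‖² = 2⟨∂ₜv, v⟩` in integrated form. Here `V` is the `E`-valued
version of `v` and `F` its time derivative. The map `ι` need not be continuous, because `hder` is
only used with fixed elements of `E`. -/
theorem energy_identity (hv : Continuous v)
    (hV : MemLp V 2 (volume.restrict (Ioc 0 T))) (hF : MemLp F 2 (volume.restrict (Ioc 0 T)))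
    (hιV : ∀ᵐ t ∂(volume.restrict (Ioc 0 T)), ι (V t) = v t)
    (hder : ∀ (w : E) (s t : ℝ), 0 < s → s ≤ t → t < T →
      inner ℝ (v t - v s) (ι w) = ∫ r in s..t, F r w)
    {a b : ℝ} (ha : 0 ≤ a) (hab : a ≤ b) (hb : b < T) :
    ‖v b‖ ^ 2 - ‖v a‖ ^ 2 = 2 * ∫ t in a..b, F t (V t) := by
  obtain ⟨V', mV, eV⟩ := exists_memLp_extension hV
  obtain ⟨F', mF, eF⟩ := exists_memLp_extension hF
  have hae : ∀ᵐ t, 0 < t → t ≤ T → ι (V' t) = v t := by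
    rw [ae_restrict_iff' measurableSet_Ioc] at hιV
    filter_upwards [hιV] with t ht h1 h2
    rw [eV t h1 h2, ht ⟨h1, h2⟩]
  have hder' : ∀ (w : E) (s t : ℝ), 0 < s → s ≤ t → t < T →
      inner ℝ (v t - v s) (ι w) = ∫ r in s..t, F' r w := by
    intro w s t hs hst ht
    rw [hder w s t hs hst ht]
    refine intervalIntegral.integral_congr fun r hr => ?_
    rw [uIcc_of_le hst] at hr
    rw [eF r (hs.trans_le hr.1) (hr.2.trans ht.le)]
  have heq : (fun h : ℝ => h⁻¹ * ∫ s in a..b, (‖v (s + h)‖ ^ 2 - ‖v s‖ ^ 2)) =ᶠ[𝓝[>] 0]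
      fun h : ℝ => h⁻¹ * ∫ τ in (0 : ℝ)..h, ∫ s in Ioc a b, F' (s + τ) (V' s + V' (s + h)) := by
    filter_upwards [Ioo_mem_nhdsGT (sub_pos.2 hb)] with h hh
    rw [integral_increment_norm_sq mV mF hae hder' ha hab hh.1 (by linarith [hh.2])]
  have l1 := (tendsto_average_increment (N := fun t => ‖v t‖ ^ 2) (by fun_prop) a b).congr' heq
  have l2 := tendsto_average_diagonal (continuous_integral_translate mF mV (Ioc a b))
  have hfin : ‖v b‖ ^ 2 - ‖v a‖ ^ 2 = ∫ s in Ioc a b, F' (s + 0) (V' s + V' (s + 0)) := 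
    tendsto_nhds_unique l1 l2
  rw [hfin, intervalIntegral.integral_of_le hab, ← integral_const_mul]
  refine setIntegral_congr_fun measurableSet_Ioc fun s hs => ?_
  have hs0 : 0 < s := ha.trans_lt hs.1
  have hsT : s ≤ T := hs.2.trans hb.le
  simp only [add_zero]
  rw [eF s hs0 hsT, eV s hs0 hsT, map_add, two_mul]

end Energy

/-! ### Weak derivatives of continuous functions -/

/-- If `ψ` is an approximate identity, `t ↦ ∫ s in (t - b)..(t - a), ψ s` is the mollified indicator
function of `[a, b]`, and its derivative is the difference of two translates of `ψ`. -/
theorem hasDerivAt_integral_window {ψ : ℝ → ℝ} (hψ : Continuous ψ) (a b t : ℝ) :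
    HasDerivAt (fun t => ∫ s in (t - b)..(t - a), ψ s) (ψ (t - a) - ψ (t - b)) t := by
  have h : ∀ c : ℝ, HasDerivAt (fun t => ∫ s in (0 : ℝ)..(t - c), ψ s) (ψ (t - c)) t := fun c => by
    have := (hψ.integral_hasStrictDerivAt 0 (t - c)).hasDerivAt.comp t
      ((hasDerivAt_id t).sub_const c)
    simpa [Function.comp_def] using this
  refine ((h a).sub (h b)).congr_of_eventuallyEq (Eventually.of_forall fun s => ?_)
  simp only [Pi.sub_apply]
  rw [intervalIntegral.integral_interval_sub_left (hψ.intervalIntegrable _ _)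
    (hψ.intervalIntegrable _ _)]

theorem contDiff_integral_window {ψ : ℝ → ℝ} (hψ : ContDiff ℝ ∞ ψ) (a b : ℝ) :
    ContDiff ℝ ∞ fun t => ∫ s in (t - b)..(t - a), ψ s := by
  rw [contDiff_infty_iff_deriv]
  refine ⟨fun t => (hasDerivAt_integral_window hψ.continuous a b t).differentiableAt, ?_⟩
  have : deriv (fun t => ∫ s in (t - b)..(t - a), ψ s) = fun t => ψ (t - a) - ψ (t - b) :=
    funext fun t => (hasDerivAt_integral_window hψ.continuous a b t).deriv
  rw [this]
  fun_prop

/-- A continuous function whose distributional derivative is an integrable function is a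
primitive of the latter. -/
theorem sub_eq_integral_of_weak_deriv {g f : ℝ → ℝ} {T : ℝ} (hg : Continuous g)
    (hf : IntegrableOn f (Ioc 0 T))
    (hw : ∀ φ : ℝ → ℝ, ContDiff ℝ ∞ φ → HasCompactSupport φ → tsupport φ ⊆ Ioo 0 T →
      ∫ t in Ioc 0 T, deriv φ t * g t = -∫ t in Ioc 0 T, φ t * f t)
    {a b : ℝ} (ha : 0 < a) (hab : a ≤ b) (hb : b < T) :
    g b - g a = ∫ t in a..b, f t := by
  rcases hab.eq_or_lt with rfl | hab
  · simp
  -- the radius keeps the supports of the mollified indicator functions inside `(0, T)`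
  obtain ⟨r, hr0, hra, hrb⟩ : ∃ r : ℝ, 0 < r ∧ r < a ∧ r < T - b := by
    obtain ⟨r, h1, h2⟩ := exists_between (lt_min ha (sub_pos.2 hb))
    exact ⟨r, h1, h2.trans_le (min_le_left _ _), h2.trans_le (min_le_right _ _)⟩
  have hεpos : ∀ n : ℕ, 0 < r / (n + 1) := fun n => by positivity
  let ψ : ℕ → ContDiffBump (0 : ℝ) := fun n =>
    ⟨r / (n + 1) / 2, r / (n + 1), by have := hεpos n; positivity, by have := hεpos n; linarith⟩
  have hε : Tendsto (fun n : ℕ => r / ((n : ℝ) + 1)) atTop (𝓝 0) := by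
    simpa using (tendsto_one_div_add_atTop_nhds_zero_nat (𝕜 := ℝ)).const_mul r |>.congr
      (fun n => by ring)
  have hψr : Tendsto (fun n => (ψ n).rOut) atTop (𝓝 0) := hε
  have hrOut : ∀ n, (ψ n).rOut ≤ r := fun n => by
    change r / ((n : ℝ) + 1) ≤ r
    exact div_le_self hr0.le (by linarith [Nat.cast_nonneg (α := ℝ) n])
  let χ : ℕ → ℝ → ℝ := fun n => (ψ n).normed volume
  have hχs : ∀ n, ContDiff ℝ ∞ (χ n) := fun n => (ψ n).contDiff_normed
  have hχ0 : ∀ n s, (ψ n).rOut ≤ |s| → χ n s = 0 := fun n s hs => by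
    have : s ∉ Function.support (χ n) := by
      change s ∉ Function.support ((ψ n).normed volume)
      rw [(ψ n).support_normed_eq]
      simpa using hs
    simpa using this
  have hχi : ∀ n, Integrable (χ n) := fun n => (ψ n).integrable_normed
  let φ : ℕ → ℝ → ℝ := fun n t => ∫ s in (t - b)..(t - a), χ n s
  have hφ0 : ∀ n t, t ∉ Ioo (a - (ψ n).rOut) (b + (ψ n).rOut) → φ n t = 0 := by
    intro n t ht
    refine (intervalIntegral.integral_congr (g := fun _ => (0 : ℝ)) fun s hs => ?_).trans (by simp)
    rw [uIcc_of_le (by linarith)] at hs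
    refine hχ0 n s ?_
    by_cases h : a - (ψ n).rOut < t
    · have h2 : b + (ψ n).rOut ≤ t := not_lt.1 fun h' => ht ⟨h, h'⟩
      exact (by linarith [hs.1] : (ψ n).rOut ≤ s).trans (le_abs_self s)
    · exact (by linarith [hs.2, not_lt.1 h] : (ψ n).rOut ≤ -s).trans (neg_le_abs s)
  have hφt : ∀ n, tsupport (φ n) ⊆ Icc (a - r) (b + r) := by
    intro n
    refine closure_minimal (fun t ht => ?_) isClosed_Icc
    by_contra h
    refine ht (hφ0 n t fun h' => h ⟨?_, ?_⟩) <;> linarith [h'.1, h'.2, hrOut n]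
  have hφb : ∀ n t, ‖φ n t‖ ≤ 1 := by
    intro n t
    have h0 : 0 ≤ φ n t := intervalIntegral.integral_nonneg (by linarith)
      fun s _ => (ψ n).nonneg_normed s
    rw [Real.norm_of_nonneg h0]
    change ∫ s in (t - b)..(t - a), χ n s ≤ 1
    rw [intervalIntegral.integral_of_le (by linarith), ← (ψ n).integral_normed (μ := volume)]
    exact setIntegral_le_integral (hχi n) (Eventually.of_forall fun s => (ψ n).nonneg_normed s)
  have hφlim : ∀ t, t ≠ a → t ≠ b →
      Tendsto (fun n => φ n t) atTop (𝓝 ((Ioc a b).indicator (fun _ => (1 : ℝ)) t)) := by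
    intro t hta htb
    have hev : ∀ δ : ℝ, 0 < δ → ∀ᶠ n in atTop, (ψ n).rOut < δ := fun δ hδ =>
      hψr.eventually (gt_mem_nhds hδ)
    by_cases ht : t ∈ Ioc a b
    · rw [indicator_of_mem ht]
      have h1 : a < t := ht.1
      have h2 : t < b := lt_of_le_of_ne ht.2 htb
      refine tendsto_const_nhds.congr' ?_
      filter_upwards [hev (t - a) (by linarith), hev (b - t) (by linarith)] with n h3 h4
      change (1 : ℝ) = ∫ s in (t - b)..(t - a), χ n s
      rw [← (ψ n).integral_normed (μ := volume), intervalIntegral.integral_of_le (by linarith),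
        setIntegral_eq_integral_of_forall_compl_eq_zero]
      intro s hs
      refine hχ0 n s ?_
      by_contra h
      rw [not_le, abs_lt] at h
      exact hs ⟨by linarith, by linarith⟩
    · rw [indicator_of_notMem ht]
      refine tendsto_const_nhds.congr' ?_
      rcases lt_or_gt_of_ne hta with h | h
      · filter_upwards [hev (a - t) (by linarith)] with n h3
        exact (hφ0 n t fun h' => by linarith [h'.1]).symm
      · have h2 : b < t := not_le.1 fun h' => ht ⟨h, h'⟩
        filter_upwards [hev (t - b) (by linarith)] with n h3
        exact (hφ0 n t fun h' => by linarith [h'.2]).symm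
  have hint : ∀ n c, Integrable fun t => χ n (t - c) * g t := fun n c => by
    refine (((hχs n).continuous.comp
      (continuous_sub_right c)).mul hg).integrable_of_hasCompactSupport ?_
    exact ((ψ n).hasCompactSupport_normed.comp_homeomorph (Homeomorph.subRight c)).mul_right
  have hχg : ∀ c, Tendsto (fun n => ∫ t, χ n (t - c) * g t) atTop (𝓝 (g c)) := by
    intro c
    refine (ContDiffBump.convolution_tendsto_right_of_continuous (μ := volume) hψr hg c).congr
      fun n => ?_
    rw [convolution_eq_swap]
    refine integral_congr_ae (Eventually.of_forall fun t => ?_)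
    change (ψ n).normed volume (c - t) * g t = (ψ n).normed volume (t - c) * g t
    rw [← (ψ n).normed_neg, neg_sub]
  -- the mollified indicator functions of `[a, b]` are admissible test functions
  have hmain : ∀ n, (∫ t, χ n (t - a) * g t) - ∫ t, χ n (t - b) * g t =
      -∫ t in Ioc 0 T, φ n t * f t := by
    intro n
    have hsub : tsupport (φ n) ⊆ Ioo 0 T := (hφt n).trans fun t ht =>
      ⟨by linarith [ht.1], by linarith [ht.2]⟩
    rw [← hw (φ n) (contDiff_integral_window (hχs n) a b)
      (isCompact_Icc.of_isClosed_subset (isClosed_tsupport _) (hφt n)) hsub,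
      ← integral_sub (hint n a) (hint n b)]
    rw [setIntegral_eq_integral_of_forall_compl_eq_zero]
    · refine integral_congr_ae (Eventually.of_forall fun t => ?_)
      have := (hasDerivAt_integral_window (hχs n).continuous a b t).deriv
      change _ = deriv (fun t => ∫ s in (t - b)..(t - a), χ n s) t * g t
      rw [this]
      ring
    · intro t ht
      have : t ∉ tsupport (deriv (φ n)) := fun h =>
        ht (Ioo_subset_Ioc_self (hsub (tsupport_deriv_subset h)))
      rw [image_eq_zero_of_notMem_tsupport this, zero_mul]
  have hlim : Tendsto (fun n => ∫ t in Ioc 0 T, φ n t * f t) atTop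
      (𝓝 (∫ t in Ioc 0 T, (Ioc a b).indicator (fun _ => (1 : ℝ)) t * f t)) := by
    refine tendsto_integral_of_dominated_convergence (fun t => ‖f t‖)
      (fun n => (contDiff_integral_window (hχs n) a b).continuous.aestronglyMeasurable.mul hf.1)
      hf.norm (fun n => Eventually.of_forall fun t => ?_) ?_
    · rw [norm_mul]
      exact mul_le_of_le_one_left (norm_nonneg _) (hφb n t)
    · refine ae_restrict_of_ae ?_
      filter_upwards [Measure.ae_ne volume a, Measure.ae_ne volume b] with t h1 h2
      exact (hφlim t h1 h2).mul_const _
  have h := tendsto_nhds_unique (((hχg a).sub (hχg b)).congr hmain) hlim.neg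
  have h' : ∫ t in Ioc 0 T, (Ioc a b).indicator (fun _ => (1 : ℝ)) t * f t = ∫ t in a..b, f t := by
    rw [intervalIntegral.integral_of_le hab.le]
    have : ∀ t, (Ioc a b).indicator (fun _ => (1 : ℝ)) t * f t = (Ioc a b).indicator f t := by
      intro t
      by_cases ht : t ∈ Ioc a b <;> simp [ht]
    simp only [this]
    rw [setIntegral_indicator measurableSet_Ioc, Ioc_inter_Ioc]
    rw [max_eq_right ha.le, min_eq_right hb.le]
  rw [h'] at h
  linarith

/-! ### Averaging over segments -/

theorem sq_lintegral_le_lintegral_sq {α : Type*} [MeasurableSpace α] {μ : Measure α}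
    [IsProbabilityMeasure μ] {h : α → ℝ≥0∞} (hh : AEMeasurable h μ) :
    (∫⁻ x, h x ∂μ) ^ 2 ≤ ∫⁻ x, h x ^ 2 ∂μ := by
  have := ENNReal.lintegral_mul_le_Lp_mul_Lq μ (p := 2) (q := 2)
    (Real.HolderConjugate.two_two) hh (aemeasurable_const (b := (1 : ℝ≥0∞)))
  simp only [Pi.mul_apply, mul_one, ENNReal.one_rpow, lintegral_const, measure_univ] at this
  calc (∫⁻ x, h x ∂μ) ^ 2 ≤ ((∫⁻ x, h x ^ (2 : ℝ) ∂μ) ^ (1 / 2 : ℝ)) ^ 2 := by gcongr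
    _ = ∫⁻ x, h x ^ 2 ∂μ := by
      rw [← ENNReal.rpow_natCast, ← ENNReal.rpow_mul]
      norm_num

/-- For `t ≥ 1/2` the homothety `x ↦ y + t(x - y)` of the plane has Jacobian `t² ≥ 1/4`. -/
theorem lintegral_comp_affine {q : Plane → ℝ≥0∞} (hq : Measurable q) (y : Plane) {t : ℝ}
    (ht : 1 / 2 ≤ t) : ∫⁻ x, q (y + t • (x - y)) ≤ 4 * ∫⁻ x, q x := by
  have ht0 : t ≠ 0 := by linarith
  calc ∫⁻ x, q (y + t • (x - y)) = ∫⁻ x, q ((y - t • y) + t • x) := by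
        refine lintegral_congr fun x => ?_
        congr 1
        module
    _ = ∫⁻ x, (fun z => q ((y - t • y) + z)) (t • x) := rfl
    _ = ∫⁻ z, q ((y - t • y) + z) ∂(Measure.map (t • ·) volume) := by
        exact (lintegral_map (f := fun z => q ((y - t • y) + z))
          (hq.comp (measurable_const_add _)) (measurable_const_smul t)).symm
    _ = ENNReal.ofReal |(t ^ 2)⁻¹| * ∫⁻ z, q z := by
        rw [Measure.map_addHaar_smul _ ht0, lintegral_smul_measure, lintegral_add_left_eq_self]
        simp
    _ ≤ 4 * ∫⁻ x, q x := by
        gcongr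
        rw [abs_of_nonneg (by positivity), show (4 : ℝ≥0∞) = ENNReal.ofReal 4 by norm_num]
        refine ENNReal.ofReal_le_ofReal ?_
        rw [inv_le_comm₀ (by positivity) (by norm_num)]
        nlinarith

/-- The average over all segments from a point of `A` to a point of `B` is controlled by the
integral over the plane: on the half of the segment that is nearer to the end in `A`, the integrand
is averaged over the ends in `A`, and likewise for `B`. -/
theorem lintegral_segment_le {q : Plane → ℝ≥0∞} (hq : Measurable q) (A B : Set Plane) :
    ∫⁻ x in A, ∫⁻ y in B, ∫⁻ t in Icc (0 : ℝ) 1, q (y + t • (x - y)) ≤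
      4 * (volume A + volume B) * ∫⁻ x, q x := by
  have hm : Measurable fun p : Plane × Plane × ℝ => q (p.2.1 + p.2.2 • (p.1 - p.2.1)) :=
    hq.comp (by fun_prop)
  have e1 : ∫⁻ x in A, ∫⁻ y in B, ∫⁻ t in Icc (0 : ℝ) 1, q (y + t • (x - y)) =
      ∫⁻ t in Icc (0 : ℝ) 1, ∫⁻ x in A, ∫⁻ y in B, q (y + t • (x - y)) := by
    have h1 : ∀ x, ∫⁻ y in B, ∫⁻ t in Icc (0 : ℝ) 1, q (y + t • (x - y)) =
        ∫⁻ t in Icc (0 : ℝ) 1, ∫⁻ y in B, q (y + t • (x - y)) := fun x =>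
      lintegral_lintegral_swap
        (hq.comp (by fun_prop : Measurable fun p : Plane × ℝ => p.1 + p.2 • (x - p.1))).aemeasurable
    simp only [h1]
    refine lintegral_lintegral_swap (Measurable.aemeasurable ?_)
    have : Measurable fun p : (Plane × ℝ) × Plane => q (p.2 + p.1.2 • (p.1.1 - p.2)) :=
      hq.comp (by fun_prop)
    exact this.lintegral_prod_right'
  rw [e1]
  have h2 : ∀ t ∈ Icc (0 : ℝ) 1, ∫⁻ x in A, ∫⁻ y in B, q (y + t • (x - y)) ≤
      4 * (volume A + volume B) * ∫⁻ x, q x := by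
    intro t ht
    rcases le_total (1 / 2) t with h | h
    · calc ∫⁻ x in A, ∫⁻ y in B, q (y + t • (x - y))
          = ∫⁻ y in B, ∫⁻ x in A, q (y + t • (x - y)) :=
            lintegral_lintegral_swap (hq.comp
              (by fun_prop : Measurable fun p : Plane × Plane => p.2 + t • (p.1 - p.2))).aemeasurable
        _ ≤ ∫⁻ y in B, 4 * ∫⁻ x, q x := lintegral_mono fun y =>
            (setLIntegral_le_lintegral _ _).trans (lintegral_comp_affine hq y h)
        _ = 4 * volume B * ∫⁻ x, q x := by
            rw [setLIntegral_const]; ring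
        _ ≤ _ := by gcongr; exact le_add_self
    · calc ∫⁻ x in A, ∫⁻ y in B, q (y + t • (x - y))
          ≤ ∫⁻ x in A, 4 * ∫⁻ x, q x := lintegral_mono fun x => by
            refine (setLIntegral_le_lintegral _ _).trans ?_
            refine le_trans (le_of_eq ?_)
              (lintegral_comp_affine hq x (by linarith : 1 / 2 ≤ 1 - t))
            refine lintegral_congr fun y => ?_
            congr 1
            module
        _ = 4 * volume A * ∫⁻ x, q x := by
            rw [setLIntegral_const]; ring
        _ ≤ _ := by gcongr; exact le_self_add
  calc ∫⁻ t in Icc (0 : ℝ) 1, ∫⁻ x in A, ∫⁻ y in B, q (y + t • (x - y))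
      ≤ ∫⁻ t in Icc (0 : ℝ) 1, 4 * (volume A + volume B) * ∫⁻ x, q x :=
        setLIntegral_mono measurable_const h2
    _ = _ := by simp

/-- A pointwise form of the mean value inequality, in square mean along the segment. -/
theorem enorm_sub_sq_le_segment {f : Plane → ℝ} (hf : ContDiff ℝ 1 f) {g : Fin 2 → Plane → ℝ}
    {x y : Plane}
    (hg : ∀ z ∈ segment ℝ x y, ∀ j, fderiv ℝ f z (EuclideanSpace.single j 1) = g j z) :
    ‖f x - f y‖ₑ ^ 2 ≤ ‖x - y‖ₑ ^ 2 *
      ∫⁻ t in Icc (0 : ℝ) 1, ∑ j, ‖g j (y + t • (x - y))‖ₑ ^ 2 := by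
  have hline : ∀ t : ℝ, HasDerivAt (fun t : ℝ => f (y + t • (x - y)))
      (fderiv ℝ f (y + t • (x - y)) (x - y)) t := by
    intro t
    have h1 : HasDerivAt (fun t : ℝ => y + t • (x - y)) (x - y) t := by
      simpa using ((hasDerivAt_id t).smul_const (x - y)).const_add y
    exact ((hf.differentiable one_ne_zero) _).hasFDerivAt.comp_hasDerivAt t h1
  have hcont : Continuous fun t : ℝ => fderiv ℝ f (y + t • (x - y)) (x - y) :=
    ((hf.continuous_fderiv one_ne_zero).comp (by fun_prop)).clm_apply continuous_const
  have hftc : f x - f y = ∫ t in Icc (0 : ℝ) 1, fderiv ℝ f (y + t • (x - y)) (x - y) := by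
    rw [integral_Icc_eq_integral_Ioc, ← intervalIntegral.integral_of_le zero_le_one,
      intervalIntegral.integral_eq_sub_of_hasDerivAt (fun t _ => hline t)
        (hcont.intervalIntegrable _ _)]
    simp
  have : IsProbabilityMeasure (volume.restrict (Icc (0 : ℝ) 1)) := ⟨by simp⟩
  have hpt : ∀ t ∈ Icc (0 : ℝ) 1, ‖fderiv ℝ f (y + t • (x - y)) (x - y)‖ₑ ^ 2 ≤
      ‖x - y‖ₑ ^ 2 * ∑ j, ‖g j (y + t • (x - y))‖ₑ ^ 2 := by
    intro t ht
    have hz : y + t • (x - y) ∈ segment ℝ x y :=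
      ⟨t, 1 - t, ht.1, by linarith [ht.2], by ring, by module⟩
    have hd : fderiv ℝ f (y + t • (x - y)) (x - y) = ∑ j, (x - y) j * g j (y + t • (x - y)) := by
      have hL : ∀ (φ : Plane →L[ℝ] ℝ) (v : Plane),
          φ v = φ (∑ j, v j • EuclideanSpace.basisFun (Fin 2) ℝ j) := fun φ v =>
        congrArg φ ((EuclideanSpace.basisFun (Fin 2) ℝ).sum_repr v).symm
      rw [hL, map_sum]
      refine Finset.sum_congr rfl fun j _ => ?_
      rw [map_smul, smul_eq_mul, EuclideanSpace.basisFun_apply,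
        hg _ hz j]
    have hr : ‖fderiv ℝ f (y + t • (x - y)) (x - y)‖ ^ 2 ≤
        ‖x - y‖ ^ 2 * ∑ j, ‖g j (y + t • (x - y))‖ ^ 2 := by
      rw [hd, EuclideanSpace.norm_sq_eq]
      simp only [Real.norm_eq_abs, sq_abs]
      exact Finset.sum_mul_sq_le_sq_mul_sq _ _ _
    have h3 := ENNReal.ofReal_le_ofReal hr
    rw [ENNReal.ofReal_mul (by positivity), ENNReal.ofReal_sum_of_nonneg (fun _ _ => by positivity)]
      at h3
    simpa only [ENNReal.ofReal_pow (norm_nonneg _), ofReal_norm] using h3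
  calc ‖f x - f y‖ₑ ^ 2
      ≤ (∫⁻ t in Icc (0 : ℝ) 1, ‖fderiv ℝ f (y + t • (x - y)) (x - y)‖ₑ) ^ 2 := by
        rw [hftc]; gcongr; exact enorm_integral_le_lintegral_enorm _
    _ ≤ ∫⁻ t in Icc (0 : ℝ) 1, ‖fderiv ℝ f (y + t • (x - y)) (x - y)‖ₑ ^ 2 :=
        sq_lintegral_le_lintegral_sq hcont.enorm.measurable.aemeasurable
    _ ≤ ∫⁻ t in Icc (0 : ℝ) 1, ‖x - y‖ₑ ^ 2 * ∑ j, ‖g j (y + t • (x - y))‖ₑ ^ 2 :=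
        setLIntegral_mono' measurableSet_Icc hpt
    _ = _ := lintegral_const_mul' _ _ (by finiteness)

/-! ### Mollification -/

/-- The mollification of `F` by the normalised bump function `ψ`. -/
noncomputable def mollify (ψ : ContDiffBump (0 : Plane)) (F : Plane → ℝ) : Plane → ℝ :=
  ψ.normed volume ⋆[ContinuousLinearMap.lsmul ℝ ℝ, volume] F

theorem mollify_apply (ψ : ContDiffBump (0 : Plane)) (F : Plane → ℝ) (x : Plane) :
    mollify ψ F x = ∫ t, ψ.normed volume (x - t) * F t := by
  rw [mollify, convolution_eq_swap]
  rfl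

theorem contDiff_mollify (ψ : ContDiffBump (0 : Plane)) {F : Plane → ℝ}
    (hF : LocallyIntegrable F volume) : ContDiff ℝ 1 (mollify ψ F) :=
  ψ.hasCompactSupport_normed.contDiff_convolution_left _ (n := 1) ψ.contDiff_normed hF

/-- Mollification does not increase the `L²` norm. -/
theorem lintegral_mollify_sq_le (ψ : ContDiffBump (0 : Plane)) {F : Plane → ℝ}
    (hF : Measurable F) : ∫⁻ x, ‖mollify ψ F x‖ₑ ^ 2 ≤ ∫⁻ x, ‖F x‖ₑ ^ 2 := by
  let χ : Plane → ℝ≥0∞ := fun x => ENNReal.ofReal (ψ.normed volume x)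
  have hχ : Measurable χ := ψ.continuous_normed.measurable.ennreal_ofReal
  have hχ1 : ∫⁻ x, χ x = 1 := by
    rw [← ofReal_integral_eq_lintegral_ofReal ψ.integrable_normed
      (Eventually.of_forall ψ.nonneg_normed), ψ.integral_normed, ENNReal.ofReal_one]
  have hpt : ∀ x, ‖mollify ψ F x‖ₑ ^ 2 ≤ ∫⁻ t, χ (x - t) * ‖F t‖ₑ ^ 2 := by
    intro x
    have hm : Measurable fun t => χ (x - t) := hχ.comp (measurable_const_sub x)
    -- the mollifier, centred at `x`, is a probability density
    have : IsProbabilityMeasure (volume.withDensity fun t => χ (x - t)) :=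
      ⟨by rw [withDensity_apply _ MeasurableSet.univ, Measure.restrict_univ,
        lintegral_sub_left_eq_self χ x, hχ1]⟩
    calc ‖mollify ψ F x‖ₑ ^ 2 ≤ (∫⁻ t, χ (x - t) * ‖F t‖ₑ) ^ 2 := by
          rw [mollify_apply]
          gcongr
          refine (enorm_integral_le_lintegral_enorm _).trans_eq (lintegral_congr fun t => ?_)
          rw [enorm_mul, Real.enorm_of_nonneg (ψ.nonneg_normed _)]
      _ = (∫⁻ t, ‖F t‖ₑ ∂(volume.withDensity fun t => χ (x - t))) ^ 2 := by
          rw [lintegral_withDensity_eq_lintegral_mul _ hm hF.enorm]; rfl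
      _ ≤ ∫⁻ t, ‖F t‖ₑ ^ 2 ∂(volume.withDensity fun t => χ (x - t)) :=
          sq_lintegral_le_lintegral_sq hF.enorm.aemeasurable
      _ = ∫⁻ t, χ (x - t) * ‖F t‖ₑ ^ 2 := by
          rw [lintegral_withDensity_eq_lintegral_mul _ hm (hF.enorm.pow_const 2)]; rfl
  calc ∫⁻ x, ‖mollify ψ F x‖ₑ ^ 2 ≤ ∫⁻ x, ∫⁻ t, χ (x - t) * ‖F t‖ₑ ^ 2 := lintegral_mono hpt
    _ = ∫⁻ t, ∫⁻ x, χ (x - t) * ‖F t‖ₑ ^ 2 :=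
        lintegral_lintegral_swap ((hχ.comp (measurable_fst.sub measurable_snd)).mul
          ((hF.enorm.pow_const 2).comp measurable_snd)).aemeasurable
    _ = ∫⁻ t, ‖F t‖ₑ ^ 2 := by
        refine lintegral_congr fun t => ?_
        have hm : Measurable fun x => χ (x - t) := hχ.comp (measurable_sub_const t)
        rw [lintegral_mul_const _ hm,
          lintegral_sub_right_eq_self χ t, hχ1, one_mul]

/-- Where the mollifier sees only the domain, mollification commutes with weak derivatives. -/
theorem fderiv_mollify {Ω : Domain} (ψ : ContDiffBump (0 : Plane)) {f g : L2 Ω} {j : Fin 2}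
    (h : IsWeakPartial Ω j f g) {x : Plane} (hx : Metric.closedBall x ψ.rOut ⊆ Ω.carrier) :
    fderiv ℝ (mollify ψ (Ω.carrier.indicator f)) x (EuclideanSpace.single j 1) =
      mollify ψ (Ω.carrier.indicator g) x := by
  set e : Plane := EuclideanSpace.single j 1
  have hΩ : MeasurableSet Ω.carrier := Ω.isOpen.measurableSet
  have hf : LocallyIntegrable (Ω.carrier.indicator f) volume := by
    refine Integrable.locallyIntegrable ((integrable_indicator_iff hΩ).2 ?_)
    exact (Lp.memLp f).integrable (by norm_num)
  have hχ : ContDiff ℝ ∞ (ψ.normed volume) := ψ.contDiff_normed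
  have hχ1 : ContDiff ℝ 1 (ψ.normed volume) := ψ.contDiff_normed
  have hflip : mollify ψ (Ω.carrier.indicator f) =
      Ω.carrier.indicator f ⋆[(ContinuousLinearMap.lsmul ℝ ℝ).flip, volume] ψ.normed volume :=
    (convolution_flip _).symm
  have hd := ψ.hasCompactSupport_normed.hasFDerivAt_convolution_right (μ := volume)
    (ContinuousLinearMap.lsmul ℝ ℝ).flip hf hχ1 x
  rw [hflip, hd.fderiv, convolution_precompR_apply _ hf (ψ.hasCompactSupport_normed.fderiv ℝ)
    (hχ1.continuous_fderiv one_ne_zero), convolution_def, mollify_apply]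
  -- the test function in the definition of the weak derivative
  let φ : Plane → ℝ := fun t => ψ.normed volume (x - t)
  have hφ : ContDiff ℝ ∞ φ := hχ.comp (contDiff_const.sub contDiff_id)
  have hφs : tsupport φ ⊆ Metric.closedBall x ψ.rOut := by
    refine closure_minimal (fun t ht => ?_) Metric.isClosed_closedBall
    have : x - t ∈ Function.support (ψ.normed volume) := ht
    rw [ψ.support_normed_eq] at this
    rw [Metric.mem_closedBall, dist_comm, dist_eq_norm]
    simpa using (Metric.mem_ball.1 this).le
  have hφc : HasCompactSupport φ :=
    (isCompact_closedBall x ψ.rOut).of_isClosed_subset (isClosed_tsupport _) hφs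
  have hφd : ∀ t, fderiv ℝ φ t e = -fderiv ℝ (ψ.normed volume) (x - t) e := by
    intro t
    have h1 : HasFDerivAt φ ((fderiv ℝ (ψ.normed volume) (x - t)).comp
        (-ContinuousLinearMap.id ℝ Plane)) t :=
      ((hχ1.differentiable one_ne_zero) _).hasFDerivAt.comp t ((hasFDerivAt_id t).const_sub x)
    rw [h1.fderiv]
    simp
  have hw := h φ hφ hφc (hφs.trans hx)
  have conv : ∀ (k : L2 Ω) (θ : Plane → ℝ),
      ∫ t, Ω.carrier.indicator k t * θ t = ∫ t, k t * θ t ∂Ω.measure := fun k θ => by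
    rw [← integral_indicator hΩ]
    refine integral_congr_ae (Eventually.of_forall fun t => ?_)
    by_cases ht : t ∈ Ω.carrier <;> simp [ht]
  have e1 := conv f (fun t => fderiv ℝ (ψ.normed volume) (x - t) e)
  have e2 := conv g φ
  have e3 : ∫ t, f t * fderiv ℝ φ t e ∂Ω.measure =
      -∫ t, f t * fderiv ℝ (ψ.normed volume) (x - t) e ∂Ω.measure := by
    rw [← integral_neg]
    simp only [hφd, mul_neg]
  have e4 : ∫ t, ψ.normed volume (x - t) * Ω.carrier.indicator g t =
      ∫ t, Ω.carrier.indicator g t * φ t :=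
    integral_congr_ae (Eventually.of_forall fun t => mul_comm _ _)
  rw [e4, e2]
  change ∫ t, (fderiv ℝ (ψ.normed volume) (x - t) e) • Ω.carrier.indicator f t = _
  have e5 : ∫ t, (fderiv ℝ (ψ.normed volume) (x - t) e) • Ω.carrier.indicator f t =
      ∫ t, Ω.carrier.indicator f t * fderiv ℝ (ψ.normed volume) (x - t) e :=
    integral_congr_ae (Eventually.of_forall fun t => mul_comm _ _)
  rw [e5, e1]
  rw [e3] at hw
  linarith

/-! ### The region that is visible from a set -/

/-- `‖∇f‖²` in `L²(Ω)`, as an extended nonnegative number. -/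
noncomputable def dirichlet {Ω : Domain} (f : H1 Ω) : ℝ≥0∞ := ∑ j, ‖f.grad j‖ₑ ^ 2

theorem dirichlet_ne_top {Ω : Domain} (f : H1 Ω) : dirichlet f ≠ ⊤ :=
  ENNReal.sum_ne_top.2 fun _ _ => by finiteness

theorem enorm_L2_sq {Ω : Domain} (g : L2 Ω) : ‖g‖ₑ ^ 2 = ∫⁻ x, ‖g x‖ₑ ^ 2 ∂Ω.measure := by
  rw [Lp.enorm_def, eLpNorm_eq_lintegral_rpow_enorm_toReal (by norm_num) (by norm_num),
    ← ENNReal.rpow_natCast, ← ENNReal.rpow_mul]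
  norm_num

/-- The part of `Ω` that is visible from every point of `B`. -/
def visibleSet (Ω : Domain) (B : Set Plane) : Set Plane :=
  {x | ∀ y ∈ B, segment ℝ x y ⊆ Ω.carrier}

/-- The part of `Ω` from which the segments to the points of `B` are at distance more than `ε` from
the complement of `Ω`. -/
def innerVisibleSet (Ω : Domain) (B : Set Plane) (ε : ℝ) : Set Plane :=
  {x | ∀ y ∈ B, ∀ z ∈ segment ℝ x y, Metric.closedBall z ε ⊆ Ω.carrier}

theorem innerVisibleSet_anti (Ω : Domain) (B : Set Plane) {ε δ : ℝ} (h : ε ≤ δ) :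
    innerVisibleSet Ω B δ ⊆ innerVisibleSet Ω B ε := fun _ hx y hy z hz =>
  (Metric.closedBall_subset_closedBall h).trans (hx y hy z hz)

/-- The segments from `x` to a compact set form a compact subset of the open set `Ω`. -/
theorem exists_mem_innerVisibleSet {Ω : Domain} {B : Set Plane} (hB : IsCompact B) {x : Plane}
    (hx : x ∈ visibleSet Ω B) : ∃ ε > 0, x ∈ innerVisibleSet Ω B ε := by
  have hK : IsCompact ((fun p : ℝ × Plane => (1 - p.1) • x + p.1 • p.2) '' (Icc 0 1 ×ˢ B)) :=
    (isCompact_Icc.prod hB).image (by fun_prop)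
  obtain ⟨δ, hδ, h⟩ := hK.exists_cthickening_subset_open Ω.isOpen (by
    rintro _ ⟨⟨t, y⟩, ⟨ht, hy⟩, rfl⟩
    exact hx y hy ⟨1 - t, t, by linarith [ht.2], ht.1, by ring, rfl⟩)
  refine ⟨δ, hδ, fun y hy z hz => ?_⟩
  obtain ⟨a, b, ha, hb, hab, rfl⟩ := hz
  refine (Metric.closedBall_subset_cthickening ?_ δ).trans h
  exact ⟨(b, y), ⟨⟨hb, by linarith⟩, hy⟩, by simp [← hab]⟩

/-- A bump function of radius `r / (n + 1)`. The ratio of the two radii is fixed, so that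
mollification converges almost everywhere. -/
noncomputable def bump {r : ℝ} (hr : 0 < r) (n : ℕ) : ContDiffBump (0 : Plane) where
  rIn := r / (n + 1) / 2
  rOut := r / (n + 1)
  rIn_pos := by positivity
  rIn_lt_rOut := half_lt_self (by positivity)

theorem tendsto_bump_rOut {r : ℝ} (hr : 0 < r) :
    Tendsto (fun n => (bump hr n).rOut) atTop (𝓝 0) := by
  simpa [bump, div_eq_mul_inv] using
    (tendsto_one_div_add_atTop_nhds_zero_nat (𝕜 := ℝ)).const_mul r

theorem ae_tendsto_mollify {F : Plane → ℝ} (hF : LocallyIntegrable F volume) {r : ℝ} (hr : 0 < r) :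
    ∀ᵐ x, Tendsto (fun n => mollify (bump hr n) F x) atTop (𝓝 (F x)) :=
  ContDiffBump.ae_convolution_tendsto_right_of_locallyIntegrable (K := 2) (tendsto_bump_rOut hr)
    (Eventually.of_forall fun n => by
      change r / ((n : ℝ) + 1) ≤ 2 * (r / (n + 1) / 2)
      linarith) hF

theorem measurable_lintegral_segment {q : Plane → ℝ≥0∞} (hq : Measurable q) (B : Set Plane) :
    (∀ x, Measurable fun y => ∫⁻ t in Icc (0 : ℝ) 1, q (y + t • (x - y))) ∧
      Measurable fun x => ∫⁻ y in B, ∫⁻ t in Icc (0 : ℝ) 1, q (y + t • (x - y)) := by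
  have hm3 : Measurable fun p : (Plane × Plane) × ℝ => q (p.1.2 + p.2 • (p.1.1 - p.1.2)) :=
    hq.comp (by fun_prop)
  have hm2 : Measurable fun p : Plane × Plane =>
      ∫⁻ t in Icc (0 : ℝ) 1, q (p.2 + t • (p.1 - p.2)) := hm3.lintegral_prod_right'
  exact ⟨fun x => hm2.comp measurable_prodMk_left, hm2.lintegral_prod_right'⟩

section Local

variable {Ω : Domain} (f : H1 Ω)

theorem lintegral_indicator_enorm_sq (g : L2 Ω) :
    ∫⁻ x, ‖Ω.carrier.indicator g x‖ₑ ^ 2 = ‖g‖ₑ ^ 2 := by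
  rw [enorm_L2_sq, ← lintegral_indicator Ω.isOpen.measurableSet]
  refine lintegral_congr fun x => ?_
  by_cases hx : x ∈ Ω.carrier <;> simp [hx]

theorem measurable_indicator_coe (g : L2 Ω) : Measurable (Ω.carrier.indicator g) :=
  (Lp.stronglyMeasurable g).measurable.indicator Ω.isOpen.measurableSet

theorem locallyIntegrable_indicator_coe (g : L2 Ω) :
    LocallyIntegrable (Ω.carrier.indicator g) volume :=
  ((integrable_indicator_iff Ω.isOpen.measurableSet).2
    ((Lp.memLp g).integrable (by norm_num))).locallyIntegrable

/-- The oscillation of a mollified function between `B` and the points that see `B` at a distance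
from the boundary where the mollified gradient is the gradient of the mollified function. -/
theorem lintegral_mollify_innerVisibleSet_le (B : Set Plane) {d : ℝ≥0∞}
    (ψ : ContDiffBump (0 : Plane))
    (hd : ∀ x ∈ innerVisibleSet Ω B ψ.rOut, ∀ y ∈ B, ‖x - y‖ₑ ≤ d) :
    ∫⁻ x in innerVisibleSet Ω B ψ.rOut, ∫⁻ y in B,
      ‖mollify ψ (Ω.carrier.indicator f.fn) x - mollify ψ (Ω.carrier.indicator f.fn) y‖ₑ ^ 2 ≤
      d ^ 2 * (4 * (volume (innerVisibleSet Ω B ψ.rOut) + volume B) * dirichlet f) := by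
  let G : Fin 2 → Plane → ℝ := fun j => mollify ψ (Ω.carrier.indicator (f.grad j))
  let q : Plane → ℝ≥0∞ := fun z => ∑ j, ‖G j z‖ₑ ^ 2
  have hGc : ∀ j, Continuous (G j) := fun j =>
    (contDiff_mollify ψ (locallyIntegrable_indicator_coe (f.grad j))).continuous
  have hq : Measurable q :=
    Finset.measurable_sum _ fun j _ => (hGc j).measurable.enorm.pow_const 2
  have hqi : ∫⁻ z, q z ≤ dirichlet f := by
    simp only [q]
    rw [lintegral_finsetSum _ fun j _ => (hGc j).measurable.enorm.pow_const 2, dirichlet]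
    refine Finset.sum_le_sum fun j _ => ?_
    exact (lintegral_mollify_sq_le ψ (measurable_indicator_coe (f.grad j))).trans_eq
      (lintegral_indicator_enorm_sq _)
  have hfc := contDiff_mollify ψ (locallyIntegrable_indicator_coe f.fn)
  have hpt : ∀ x ∈ innerVisibleSet Ω B ψ.rOut, ∀ y ∈ B,
      ‖mollify ψ (Ω.carrier.indicator f.fn) x - mollify ψ (Ω.carrier.indicator f.fn) y‖ₑ ^ 2 ≤
      d ^ 2 * ∫⁻ t in Icc (0 : ℝ) 1, q (y + t • (x - y)) := by
    intro x hx y hy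
    refine (enorm_sub_sq_le_segment (g := G) hfc fun z hz j =>
      fderiv_mollify ψ (f.2 j) (hx y hy z hz)).trans ?_
    gcongr
    exact hd x hx y hy
  obtain ⟨hm2x, hm1⟩ := measurable_lintegral_segment hq B
  refine le_trans (setLIntegral_mono (hm1.const_mul (d ^ 2)) fun x hx => ?_) ?_
  · rw [← lintegral_const_mul _ (hm2x x)]
    exact setLIntegral_mono ((hm2x x).const_mul _) (hpt x hx)
  · rw [lintegral_const_mul _ hm1]
    exact mul_le_mul_right ((lintegral_segment_le hq _ _).trans (mul_le_mul_right hqi _)) _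

end Local

/-! ### Poincaré sets -/

variable {Ω : Domain}

theorem visibleSet_subset {B : Set Plane} (hB : B.Nonempty) : visibleSet Ω B ⊆ Ω.carrier :=
  fun x hx =>
  hB.elim fun y hy => hx y hy (left_mem_segment ℝ x y)

theorem innerVisibleSet_subset_visibleSet {B : Set Plane} {ε : ℝ} (hε : 0 ≤ ε) :
    innerVisibleSet Ω B ε ⊆ visibleSet Ω B := fun _ hx y hy z hz =>
  hx y hy z hz (Metric.mem_closedBall_self hε)

theorem enorm_sub_le_ediam {B : Set Plane} {x y : Plane} (hx : x ∈ visibleSet Ω B) (hy : y ∈ B) :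
    ‖x - y‖ₑ ≤ Metric.ediam Ω.carrier := by
  rw [← edist_eq_enorm_sub]
  exact Metric.edist_le_ediam_of_mem (hx y hy (left_mem_segment ℝ x y))
    (hx y hy (right_mem_segment ℝ x y))

/-- Passing to the limit with Fatou's lemma in the estimate for the mollified functions. -/
theorem lintegral_innerVisibleSet_le (f : H1 Ω) {B : Set Plane} (hB : B.Nonempty)
    {ε : ℝ} (hε : 0 < ε) :
    ∫⁻ x in innerVisibleSet Ω B ε, ∫⁻ y in B,
      ‖Ω.carrier.indicator f.fn x - Ω.carrier.indicator f.fn y‖ₑ ^ 2 ≤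
      Metric.ediam Ω.carrier ^ 2 * (4 * (volume Ω.carrier + volume B) * dirichlet f) := by
  have hm : ∀ n, Continuous (mollify (bump hε n) (Ω.carrier.indicator f.fn)) := fun n =>
    (contDiff_mollify _ (locallyIntegrable_indicator_coe f.fn)).continuous
  have hlim := ae_tendsto_mollify (locallyIntegrable_indicator_coe f.fn) hε
  generalize hF : Ω.carrier.indicator (f.fn : Plane → ℝ) = F at *
  generalize hφ : (fun n => mollify (bump hε n) F) = φ
  have hφ' : ∀ n, mollify (bump hε n) F = φ n := fun n => congrFun hφ n
  simp only [hφ'] at hm hlim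
  have hk : ∀ n, Measurable fun p : Plane × Plane => ‖φ n p.1 - φ n p.2‖ₑ ^ 2 := fun n =>
    ((hm n).measurable.comp measurable_fst |>.sub
      ((hm n).measurable.comp measurable_snd)).enorm.pow_const 2
  have hbound : ∀ n, ∫⁻ x in innerVisibleSet Ω B ε, ∫⁻ y in B, ‖φ n x - φ n y‖ₑ ^ 2 ≤
      Metric.ediam Ω.carrier ^ 2 * (4 * (volume Ω.carrier + volume B) * dirichlet f) := by
    intro n
    have h0 : (bump hε n).rOut ≤ ε :=
      div_le_self hε.le (by linarith [Nat.cast_nonneg (α := ℝ) n])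
    have hsub := innerVisibleSet_subset_visibleSet (Ω := Ω) (B := B) (bump hε n).rOut_pos.le
    refine (lintegral_mono_set (innerVisibleSet_anti Ω B h0)).trans ?_
    have := lintegral_mollify_innerVisibleSet_le f B (bump hε n)
      fun x hx y hy => enorm_sub_le_ediam (hsub hx) hy
    rw [hF, hφ'] at this
    refine this.trans ?_
    gcongr
    exact hsub.trans (visibleSet_subset hB)
  calc ∫⁻ x in innerVisibleSet Ω B ε, ∫⁻ y in B, ‖F x - F y‖ₑ ^ 2
      ≤ ∫⁻ x in innerVisibleSet Ω B ε, liminf (fun n => ∫⁻ y in B, ‖φ n x - φ n y‖ₑ ^ 2) atTop := by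
        refine lintegral_mono_ae ?_
        filter_upwards [ae_restrict_of_ae hlim] with x hx
        refine le_trans (lintegral_mono_ae ?_)
          (lintegral_liminf_le fun n => (hk n).comp measurable_prodMk_left)
        filter_upwards [ae_restrict_of_ae hlim] with y hy
        exact (ENNReal.Tendsto.pow (n := 2) (hx.sub hy).enorm).liminf_eq.ge
    _ ≤ liminf (fun n => ∫⁻ x in innerVisibleSet Ω B ε, ∫⁻ y in B, ‖φ n x - φ n y‖ₑ ^ 2) atTop :=
        lintegral_liminf_le fun n => (hk n).lintegral_prod_right'
    _ ≤ _ := liminf_le_of_le (by isBoundedDefault) fun b hb => by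
        obtain ⟨n, hn⟩ := hb.exists
        exact hn.trans (hbound n)

/-- The oscillation of `f` between `B` and the set of the points that see `B`. -/
theorem lintegral_visibleSet_le (f : H1 Ω) {B : Set Plane} (hB : IsCompact B) (hB0 : B.Nonempty) :
    ∫⁻ x in visibleSet Ω B, ∫⁻ y in B,
      ‖Ω.carrier.indicator f.fn x - Ω.carrier.indicator f.fn y‖ₑ ^ 2 ≤
      Metric.ediam Ω.carrier ^ 2 * (4 * (volume Ω.carrier + volume B) * dirichlet f) := by
  have hpos : ∀ n : ℕ, (0 : ℝ) < 1 / (n + 1) := fun n => by positivity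
  -- the sets `innerVisibleSet` need not be measurable: the integral over a countable directed
  -- union of arbitrary sets is the supremum of the integrals
  have hU : visibleSet Ω B = ⋃ n : ℕ, innerVisibleSet Ω B (1 / (n + 1)) := by
    refine Subset.antisymm (fun x hx => ?_) (iUnion_subset fun n =>
      innerVisibleSet_subset_visibleSet (hpos n).le)
    obtain ⟨ε, hε, hxε⟩ := exists_mem_innerVisibleSet hB hx
    obtain ⟨n, hn⟩ := exists_nat_one_div_lt hε
    exact mem_iUnion.2 ⟨n, innerVisibleSet_anti Ω B hn.le hxε⟩
  have hmono : Monotone fun n : ℕ => innerVisibleSet Ω B (1 / (n + 1)) := fun m n hmn =>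
    innerVisibleSet_anti Ω B (by gcongr)
  rw [hU, setLIntegral_iUnion_of_directed _ hmono.directed_le]
  exact iSup_le fun n => lintegral_innerVisibleSet_le f hB0 (hpos n)

/-- A set `A` is a Poincaré set if the oscillation of `f` on `A` is controlled by the gradient of
`f` on the whole of the domain, uniformly in `f ∈ H¹(Ω)`. Outside of `Ω` the function `f` is extended
by zero; only subsets `A` of `Ω` are of interest. -/
def IsPoincareSet (Ω : Domain) (A : Set Plane) : Prop :=
  ∃ C : ℝ≥0∞, C ≠ ⊤ ∧ ∀ f : H1 Ω, ∃ c : ℝ,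
    ∫⁻ x in A, ‖Ω.carrier.indicator f.fn x - c‖ₑ ^ 2 ≤ C * dirichlet f

theorem isPoincareSet_visibleSet {B : Set Plane} (hB : IsCompact B) (hB0 : volume B ≠ 0) :
    IsPoincareSet Ω (visibleSet Ω B) := by
  -- the constant is the value of `f` at a point of `B` where the integral over the visible set is
  -- at most its average
  refine ⟨Metric.ediam Ω.carrier ^ 2 * (4 * (volume Ω.carrier + volume B)) / volume B, ?_,
    fun f => ?_⟩
  · have h1 : Metric.ediam Ω.carrier ≠ ⊤ := Ω.isBounded.ediam_ne_top
    have h2 : volume Ω.carrier ≠ ⊤ := Ω.isBounded.measure_lt_top.ne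
    have h3 : volume B ≠ ⊤ := hB.measure_lt_top.ne
    finiteness
  have hB1 : B.Nonempty := nonempty_of_measure_ne_zero hB0
  have hB2 : volume B ≠ ⊤ := hB.measure_lt_top.ne
  have hvis := lintegral_visibleSet_le f hB hB1
  have hmF := measurable_indicator_coe f.fn
  generalize Ω.carrier.indicator (f.fn : Plane → ℝ) = F at *
  have hk : Measurable fun p : Plane × Plane => ‖F p.1 - F p.2‖ₑ ^ 2 :=
    (hmF.comp measurable_fst |>.sub (hmF.comp measurable_snd)).enorm.pow_const 2
  rw [lintegral_lintegral_swap hk.aemeasurable] at hvis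
  obtain ⟨y, -, hy⟩ := exists_le_setLAverage hB0 hB2
    (f := fun y => ∫⁻ x in visibleSet Ω B, ‖F x - F y‖ₑ ^ 2) hk.lintegral_prod_left'.aemeasurable
  refine ⟨F y, hy.trans ?_⟩
  rw [setLAverage_eq]
  refine (ENNReal.div_le_div_right hvis _).trans_eq ?_
  simp only [div_eq_mul_inv]
  ring

theorem IsPoincareSet.mono {A A' : Set Plane} (h : IsPoincareSet Ω A) (hA : A' ⊆ A) :
    IsPoincareSet Ω A' := by
  obtain ⟨C, hC, h⟩ := h
  refine ⟨C, hC, fun f => ?_⟩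
  obtain ⟨c, hc⟩ := h f
  exact ⟨c, (lintegral_mono_set hA).trans hc⟩

theorem enorm_add_sq_le (a b : ℝ) : ‖a + b‖ₑ ^ 2 ≤ 2 * (‖a‖ₑ ^ 2 + ‖b‖ₑ ^ 2) := by
  have h : ‖a + b‖ ^ 2 ≤ 2 * (‖a‖ ^ 2 + ‖b‖ ^ 2) := by
    simp only [Real.norm_eq_abs, sq_abs]
    nlinarith [sq_nonneg (a - b)]
  have h' := ENNReal.ofReal_le_ofReal h
  rw [ENNReal.ofReal_mul (by norm_num), ENNReal.ofReal_add (by positivity) (by positivity),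
    ENNReal.ofReal_pow (norm_nonneg _), ENNReal.ofReal_pow (norm_nonneg _),
    ENNReal.ofReal_pow (norm_nonneg _), ofReal_norm, ofReal_norm, ofReal_norm] at h'
  simpa using h'

/-- Two overlapping Poincaré sets can be joined: on the overlap the two constants must be close to
each other. -/
theorem IsPoincareSet.union {A A' V : Set Plane} (h : IsPoincareSet Ω A) (h' : IsPoincareSet Ω A')
    (hV : V ⊆ A) (hV' : V ⊆ A') (hV0 : volume V ≠ 0) (hV1 : volume V ≠ ⊤) (hA' : volume A' ≠ ⊤) :
    IsPoincareSet Ω (A ∪ A') := by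
  obtain ⟨C, hC, h⟩ := h
  obtain ⟨C', hC', h'⟩ := h'
  refine ⟨C + 2 * (C' + 2 * (C + C') / volume V * volume A'), by finiteness, fun f => ?_⟩
  obtain ⟨c, hc⟩ := h f
  obtain ⟨c', hc'⟩ := h' f
  refine ⟨c, ?_⟩
  have hmF := measurable_indicator_coe f.fn
  generalize Ω.carrier.indicator (f.fn : Plane → ℝ) = F at *
  have hm : ∀ k : ℝ, Measurable fun x => ‖F x - k‖ₑ ^ 2 := fun k =>
    (hmF.sub_const k).enorm.pow_const 2
  have hcc : ‖c' - c‖ₑ ^ 2 ≤ 2 * (C + C') / volume V * dirichlet f := by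
    have h1 : ‖c' - c‖ₑ ^ 2 * volume V ≤ 2 * (C + C') * dirichlet f := by
      rw [← setLIntegral_const]
      calc ∫⁻ _ in V, ‖c' - c‖ₑ ^ 2
          ≤ ∫⁻ x in V, 2 * (‖F x - c‖ₑ ^ 2 + ‖F x - c'‖ₑ ^ 2) := by
            refine lintegral_mono fun x => ?_
            have := enorm_add_sq_le (F x - c) (-(F x - c'))
            rw [enorm_neg] at this
            refine le_of_eq_of_le ?_ this
            congr 2
            ring
        _ = 2 * ((∫⁻ x in V, ‖F x - c‖ₑ ^ 2) + ∫⁻ x in V, ‖F x - c'‖ₑ ^ 2) := by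
            have hs : Measurable fun x => ‖F x - c‖ₑ ^ 2 + ‖F x - c'‖ₑ ^ 2 := (hm c).add (hm c')
            rw [lintegral_const_mul _ hs, lintegral_add_right _ (hm c')]
        _ ≤ 2 * (C * dirichlet f + C' * dirichlet f) := by
            gcongr
            · exact (lintegral_mono_set hV).trans hc
            · exact (lintegral_mono_set hV').trans hc'
        _ = _ := by ring
    refine ((ENNReal.le_div_iff_mul_le (Or.inl hV0) (Or.inl hV1)).2 h1).trans_eq ?_
    simp only [div_eq_mul_inv]
    ring
  calc ∫⁻ x in A ∪ A', ‖F x - c‖ₑ ^ 2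
      ≤ (∫⁻ x in A, ‖F x - c‖ₑ ^ 2) + ∫⁻ x in A', ‖F x - c‖ₑ ^ 2 := lintegral_union_le _ _ _
    _ ≤ C * dirichlet f + ∫⁻ x in A', 2 * (‖F x - c'‖ₑ ^ 2 + ‖c' - c‖ₑ ^ 2) := by
        refine add_le_add hc (lintegral_mono fun x => ?_)
        simpa using enorm_add_sq_le (F x - c') (c' - c)
    _ ≤ C * dirichlet f + 2 * (C' * dirichlet f +
          2 * (C + C') / volume V * dirichlet f * volume A') := by
        rw [lintegral_const_mul _ ((hm c').add_const _), lintegral_add_right _ measurable_const,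
          setLIntegral_const]
        gcongr
    _ = _ := by ring

/-! ### Visibility near the boundary and chaining -/

theorem isPoincareSet_visibleSet_of_interior {B : Set Plane} (hB : IsCompact B)
    (hB0 : (interior B).Nonempty) : IsPoincareSet Ω (visibleSet Ω B) ∧ visibleSet Ω B ⊆ Ω.carrier :=
  ⟨isPoincareSet_visibleSet hB (Measure.measure_pos_of_nonempty_interior _ hB0).ne',
    visibleSet_subset (hB0.mono interior_subset)⟩

/-- Near an interior point, all points are visible from a small disc. -/
theorem exists_poincareSet_interior {x : Plane} (hx : x ∈ Ω.carrier) :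
    ∃ A ⊆ Ω.carrier, IsPoincareSet Ω A ∧ A ∈ 𝓝 x := by
  obtain ⟨r, hr, h⟩ := Metric.nhds_basis_closedBall.mem_iff.1 (Ω.isOpen.mem_nhds hx)
  obtain ⟨h1, h2⟩ := isPoincareSet_visibleSet_of_interior (Ω := Ω) (isCompact_closedBall x r)
    ⟨x, Metric.ball_subset_interior_closedBall (Metric.mem_ball_self hr)⟩
  refine ⟨_, h2, h1, mem_of_superset (Metric.closedBall_mem_nhds x hr) fun z hz y hy => ?_⟩
  exact ((convex_closedBall x r).segment_subset hz hy).trans h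

theorem abs_coord_sub_le (e : Plane ≃ₗᵢ[ℝ] Plane) (x y : Plane) (i : Fin 2) :
    |e x i - e y i| ≤ dist x y := by
  rw [dist_eq_norm, ← e.norm_map, map_sub]
  exact PiLp.norm_apply_le (e x - e y) i

/-- Near a boundary point, all points of `Ω` are visible from a small disc that lies above the
boundary point in the graph direction: the connecting segments are steeper than the graph. -/
theorem exists_poincareSet_boundary {x : Plane} (hx : x ∈ frontier Ω.carrier) :
    ∃ A ⊆ Ω.carrier, IsPoincareSet Ω A ∧ ∃ N ∈ 𝓝 x, N ∩ Ω.carrier ⊆ A := by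
  obtain ⟨e, γ, K, hγ, hΩ⟩ := Ω.hasLipschitzBoundary x hx
  obtain ⟨r, hr, hball⟩ := Metric.eventually_nhds_iff_ball.1 hΩ
  -- `δ` is the radius of the disc, and of the neighbourhood of `x`: the segments between them rise
  -- by at least `r / 2 - 2δ` on a horizontal distance of at most `2δ`
  obtain ⟨δ, hδ, hδr, hδK⟩ : ∃ δ : ℝ, 0 < δ ∧ 2 * δ < r ∧ (K + 1) * (2 * δ) ≤ r / 2 := by
    refine ⟨r / (4 * (K + 1)), by positivity, ?_, ?_⟩
    · rw [mul_div_assoc', div_lt_iff₀ (by positivity)]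
      nlinarith [K.coe_nonneg]
    · apply le_of_eq
      field_simp
      ring
  set p : Plane := x + (r / 2) • e.symm (EuclideanSpace.single 1 1) with hp
  have hep0 : e p 0 = e x 0 := by simp [hp]
  have hep1 : e p 1 = e x 1 + r / 2 := by simp [hp]
  have hpx : dist p x = r / 2 := by
    rw [dist_eq_norm, hp, add_sub_cancel_left, norm_smul, e.symm.norm_map]
    simp [abs_of_pos hr]
  have hδr2 : δ < r / 2 := by linarith
  obtain ⟨h1, h2⟩ := isPoincareSet_visibleSet_of_interior (Ω := Ω) (isCompact_closedBall p δ)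
    ⟨p, Metric.ball_subset_interior_closedBall (Metric.mem_ball_self hδ)⟩
  refine ⟨_, h2, h1, Metric.ball x δ, Metric.ball_mem_nhds x hδ, ?_⟩
  rintro z ⟨hzx, hzΩ⟩ y hy w ⟨s, t, hs, ht, hst, rfl⟩
  have hzr : z ∈ Metric.ball x r := Metric.ball_subset_ball (by linarith) hzx
  have hyr : y ∈ Metric.ball x r := by
    rw [Metric.mem_ball]
    have := dist_triangle y p x
    rw [Metric.mem_closedBall] at hy
    linarith
  have hw : s • z + t • y ∈ Metric.ball x r :=
    (convex_ball x r) hzr hyr hs ht hst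
  rw [hball _ hw]
  have hzγ := (hball z hzr).1 hzΩ
  have a0 := abs_le.1 (abs_coord_sub_le e z x 0)
  have a1 := abs_le.1 (abs_coord_sub_le e z x 1)
  have b0 := abs_le.1 (abs_coord_sub_le e y p 0)
  have b1 := abs_le.1 (abs_coord_sub_le e y p 1)
  rw [Metric.mem_ball] at hzx
  rw [Metric.mem_closedBall] at hy
  have hew : ∀ i, e (s • z + t • y) i = s * e z i + t * e y i := fun i => by simp
  have hs' : s = 1 - t := by linarith
  have hdiff : |e y 0 - e z 0| ≤ 2 * δ := abs_le.2 ⟨by linarith, by linarith⟩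
  have hrise : r / 2 - 2 * δ ≤ e y 1 - e z 1 := by linarith
  have hlip : γ (e (s • z + t • y) 0) - γ (e z 0) ≤ K * (t * (2 * δ)) := by
    have := hγ.dist_le_mul (e (s • z + t • y) 0) (e z 0)
    rw [Real.dist_eq, Real.dist_eq] at this
    refine (le_abs_self _).trans (this.trans ?_)
    gcongr
    rw [hew, hs', show (1 - t) * e z 0 + t * e y 0 - e z 0 = t * (e y 0 - e z 0) by ring, abs_mul,
      abs_of_nonneg ht]
    gcongr
  have hrise' : t * (K * (2 * δ)) ≤ t * (e y 1 - e z 1) := by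
    gcongr
    linarith
  have hew1 : e (s • z + t • y) 1 = e z 1 + t * (e y 1 - e z 1) := by rw [hew, hs']; ring
  linarith

theorem exists_poincareSet_closure {x : Plane} (hx : x ∈ closure Ω.carrier) :
    ∃ A ⊆ Ω.carrier, IsPoincareSet Ω A ∧ ∃ N ∈ 𝓝 x, N ∩ Ω.carrier ⊆ A := by
  by_cases h : x ∈ Ω.carrier
  · obtain ⟨A, h1, h2, h3⟩ := exists_poincareSet_interior h
    exact ⟨A, h1, h2, A, h3, inter_subset_left⟩
  · exact exists_poincareSet_boundary ⟨hx, fun h' => h (interior_subset h')⟩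

theorem measure_ne_top_of_subset {A : Set Plane} (h : A ⊆ Ω.carrier) : volume A ≠ ⊤ :=

  ne_top_of_le_ne_top Ω.isBounded.measure_lt_top.ne (measure_mono h)

theorem IsPoincareSet.union_of_mem_nhds {A A' : Set Plane} (h : IsPoincareSet Ω A)
    (h' : IsPoincareSet Ω A') (hA : A ⊆ Ω.carrier) (hA' : A' ⊆ Ω.carrier) {x : Plane}
    (hx : A ∈ 𝓝 x) (hx' : A' ∈ 𝓝 x) : IsPoincareSet Ω (A ∪ A') :=
  h.union h' inter_subset_left inter_subset_right
    (Measure.measure_pos_of_mem_nhds volume (inter_mem hx hx')).ne'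
    (measure_ne_top_of_subset (inter_subset_left.trans hA)) (measure_ne_top_of_subset hA')

/-- Poincaré sets can be prolonged along the connected set `Ω`. -/
theorem exists_poincareSet_of_mem {x y : Plane} (hx : x ∈ Ω.carrier) (hy : y ∈ Ω.carrier) :
    ∃ A ⊆ Ω.carrier, IsPoincareSet Ω A ∧ A ∈ 𝓝 x ∧ A ∈ 𝓝 y := by
  refine Ω.isConnected.isPreconnected.induction₂
    (fun x y => ∃ A ⊆ Ω.carrier, IsPoincareSet Ω A ∧ A ∈ 𝓝 x ∧ A ∈ 𝓝 y) ?_ ?_ ?_ hx hy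
  · intro x hx
    obtain ⟨A, h1, h2, h3⟩ := exists_poincareSet_interior hx
    filter_upwards [mem_nhdsWithin_of_mem_nhds (eventually_mem_nhds_iff.2 h3)] with y hy
    exact ⟨A, h1, h2, h3, hy⟩
  · rintro x y z - - - ⟨A, h1, h2, h3, h4⟩ ⟨A', h1', h2', h3', h4'⟩
    exact ⟨A ∪ A', union_subset h1 h1', h2.union_of_mem_nhds h2' h1 h1' h4 h3',
      mem_of_superset h3 subset_union_left, mem_of_superset h4' subset_union_right⟩
  · rintro x y - - ⟨A, h1, h2, h3, h4⟩
    exact ⟨A, h1, h2, h4, h3⟩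

/-- The **Poincaré inequality** on `Ω`, up to the choice of the constant that is subtracted. -/
theorem isPoincareSet_carrier (Ω : Domain) : IsPoincareSet Ω Ω.carrier := by
  obtain ⟨x₀, hx₀⟩ := Ω.isConnected.nonempty
  have hcomp : IsCompact (closure Ω.carrier) := Ω.isBounded.isCompact_closure
  -- the Poincaré sets are all linked to `x₀`, so that any two of them overlap
  have key : ∃ A ⊆ Ω.carrier, IsPoincareSet Ω A ∧ A ∈ 𝓝 x₀ ∧ closure Ω.carrier ∩ Ω.carrier ⊆ A := by
    refine hcomp.induction_on
      (p := fun S => ∃ A ⊆ Ω.carrier, IsPoincareSet Ω A ∧ A ∈ 𝓝 x₀ ∧ S ∩ Ω.carrier ⊆ A) ?_ ?_ ?_ ?_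
    · obtain ⟨A, h1, h2, h3⟩ := exists_poincareSet_interior hx₀
      exact ⟨A, h1, h2, h3, by simp⟩
    · rintro S S' hS ⟨A, h1, h2, h3, h4⟩
      exact ⟨A, h1, h2, h3, (inter_subset_inter_left _ hS).trans h4⟩
    · rintro S S' ⟨A, h1, h2, h3, h4⟩ ⟨A', h1', h2', h3', h4'⟩
      refine ⟨A ∪ A', union_subset h1 h1', h2.union_of_mem_nhds h2' h1 h1' h3 h3',
        mem_of_superset h3 subset_union_left, ?_⟩
      rw [union_inter_distrib_right]
      exact union_subset_union h4 h4'
    · intro x hx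
      obtain ⟨A, h1, h2, N, hN, hNA⟩ := exists_poincareSet_closure hx
      obtain ⟨z, hzN, hzΩ⟩ := mem_closure_iff_nhds.1 hx _ (interior_mem_nhds.2 hN)
      have hAz : A ∈ 𝓝 z := mem_of_superset
        (inter_mem (mem_interior_iff_mem_nhds.1 hzN) (Ω.isOpen.mem_nhds hzΩ)) hNA
      obtain ⟨A', h1', h2', h3', h4'⟩ := exists_poincareSet_of_mem hx₀ hzΩ
      exact ⟨N, mem_nhdsWithin_of_mem_nhds hN, A' ∪ A, union_subset h1' h1,
        h2'.union_of_mem_nhds h2 h1' h1 h4' hAz, mem_of_superset h3' subset_union_left,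
        hNA.trans subset_union_right⟩
  obtain ⟨A, -, h2, -, h4⟩ := key
  exact h2.mono fun x hx => h4 ⟨subset_closure hx, hx⟩

/-! ### Constants and mean values -/

theorem inner_const (g : L2 Ω) (c : ℝ) :
    inner ℝ g (Lp.const 2 Ω.measure c) = c * ∫ x, g x ∂Ω.measure := by
  rw [L2.inner_def, ← integral_const_mul]
  refine integral_congr_ae ?_
  filter_upwards [Lp.coeFn_const 2 Ω.measure c] with x hx
  rw [hx]
  simp

theorem inner_constant (u : X0 Ω) (C : Fin 2 → ℝ) :
    inner ℝ u (constant Ω C) = ∑ i, C i * ∫ x, u i x ∂Ω.measure := by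
  rw [PiLp.inner_apply]
  exact Finset.sum_congr rfl fun i _ => inner_const (u i) (C i)

theorem integral_sub_constant (u : X0 Ω) (C : Fin 2 → ℝ) (i : Fin 2) :
    ∫ x, (u - constant Ω C) i x ∂Ω.measure =
      (∫ x, u i x ∂Ω.measure) - C i * (volume Ω.carrier).toReal := by
  have h : (u - constant Ω C) i = u i - Lp.const 2 Ω.measure (C i) := rfl
  rw [h]
  have e : ∫ x, (u i - Lp.const 2 Ω.measure (C i) : L2 Ω) x ∂Ω.measure =
      ∫ x, (u i x - C i) ∂Ω.measure := by
    refine integral_congr_ae ?_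
    filter_upwards [Lp.coeFn_sub (u i) (Lp.const 2 Ω.measure (C i)),
      Lp.coeFn_const 2 Ω.measure (C i)] with x h1 h2
    rw [h1, Pi.sub_apply, h2, Function.const_apply]
  rw [e, integral_sub ((Lp.memLp (u i)).integrable (by norm_num)) (integrable_const _),
    integral_const, smul_eq_mul, mul_comm (C i)]
  simp [Measure.real]

theorem volume_toReal_pos (Ω : Domain) : 0 < (volume Ω.carrier).toReal :=
  ENNReal.toReal_pos (Ω.isOpen.measure_pos volume Ω.isConnected.nonempty).ne'
    Ω.isBounded.measure_lt_top.ne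

/-- Constants have weak gradient zero: the integral of a derivative of a test function vanishes. -/
theorem isWeakPartial_const (j : Fin 2) (c : ℝ) :
    IsWeakPartial Ω j (Lp.const 2 Ω.measure c) 0 := by
  intro φ hφ hc hs
  set e : Plane := EuclideanSpace.single j 1
  have hi : Integrable (fun x => fderiv ℝ φ x e) volume :=
    (continuous_partial hφ e).integrable_of_hasCompactSupport (hasCompactSupport_partial hc e)
  have h0 : ∫ x, fderiv ℝ φ x e = 0 := by
    have := integral_mul_fderiv_eq_neg_fderiv_mul_of_integrable (μ := (volume : Measure Plane))
      (f := fun _ => (1 : ℝ)) (g := φ) (v := e) (by simp) (by simpa using hi)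
      (by simpa using hφ.continuous.integrable_of_hasCompactSupport hc)
      (fun x _ => differentiableAt_const _) (fun x _ => hφ.differentiable (by simp) x)
    simpa using this
  have h1 : ∫ x, (Lp.const 2 Ω.measure c : L2 Ω) x * fderiv ℝ φ x e ∂Ω.measure = 0 := by
    have : ∫ x, (Lp.const 2 Ω.measure c : L2 Ω) x * fderiv ℝ φ x e ∂Ω.measure =
        ∫ x, c * fderiv ℝ φ x e ∂Ω.measure := by
      refine integral_congr_ae ?_
      filter_upwards [Lp.coeFn_const 2 Ω.measure c] with x hx
      rw [hx, Function.const_apply]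
    rw [this, integral_const_mul, setIntegral_eq_integral_of_forall_compl_eq_zero, h0, mul_zero]
    intro x hx
    rw [fderiv_of_notMem_tsupport (𝕜 := ℝ) fun h => hx (hs h)]
    rfl
  have h2 : ∫ x, (0 : L2 Ω) x * φ x ∂Ω.measure = 0 := by
    refine integral_eq_zero_of_ae ?_
    filter_upwards [Lp.coeFn_zero ℝ 2 Ω.measure] with x hx
    rw [hx, Pi.zero_apply, zero_mul]
  rw [h1, h2, neg_zero]

/-- The constant function `c`, as an element of `H¹(Ω)`. -/
noncomputable def H1.const (Ω : Domain) (c : ℝ) : H1 Ω :=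
  ⟨WithLp.toLp 2 (Lp.const 2 Ω.measure c, 0), fun j => isWeakPartial_const j c⟩

/-- The constant function `C`, as an element of `X₁`. -/
noncomputable def X1.const (Ω : Domain) (C : Fin 2 → ℝ) : X1 Ω :=
  (WithLp.toLp 2 fun i => H1.const Ω (C i) : PiLp 2 fun _ : Fin 2 => H1 Ω)

theorem X1.toX0_const (C : Fin 2 → ℝ) : (X1.const Ω C).toX0 = constant Ω C := rfl

theorem X1.grad_const (C : Fin 2 → ℝ) (i j : Fin 2) : ((X1.const Ω C).comp i).grad j = 0 := rfl

/-- The inclusion of `X₁` in `X₀` as a linear map. -/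
noncomputable def X1.toX0L (Ω : Domain) : X1 Ω →ₗ[ℝ] X0 Ω where
  toFun := X1.toX0
  map_add' _ _ := rfl
  map_smul' _ _ := rfl

theorem X1.grad_sub (v w : X1 Ω) (i j : Fin 2) :
    ((v - w).comp i).grad j = (v.comp i).grad j - (w.comp i).grad j := rfl

/-! ### The Poincaré inequality -/

/-- The **Poincaré inequality** for functions of mean value zero. -/
theorem exists_poincare_constant (Ω : Domain) : ∃ C₀ : ℝ, 0 < C₀ ∧ ∀ f : H1 Ω,
    ∫ x, f.fn x ∂Ω.measure = 0 → C₀ * ‖f.fn‖ ^ 2 ≤ ∑ j, ‖f.grad j‖ ^ 2 := by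
  obtain ⟨C, hC, h⟩ := isPoincareSet_carrier Ω
  refine ⟨(C.toReal + 1)⁻¹, by positivity, fun f hf => ?_⟩
  obtain ⟨c, hc⟩ := h f
  have e1 : ∫⁻ x in Ω.carrier, ‖Ω.carrier.indicator f.fn x - c‖ₑ ^ 2 =
      ‖f.fn - Lp.const 2 Ω.measure c‖ₑ ^ 2 := by
    rw [enorm_L2_sq]
    refine lintegral_congr_ae ?_
    filter_upwards [Lp.coeFn_sub f.fn (Lp.const 2 Ω.measure c), Lp.coeFn_const 2 Ω.measure c,
      ae_restrict_mem Ω.isOpen.measurableSet] with x h1 h2 h3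
    rw [h1, Pi.sub_apply, h2, Function.const_apply, indicator_of_mem h3]
  rw [e1] at hc
  have hc' := ENNReal.toReal_mono (by have := dirichlet_ne_top f; finiteness) hc
  rw [ENNReal.toReal_mul, dirichlet, ENNReal.toReal_sum (fun _ _ => by finiteness)] at hc'
  simp only [ENNReal.toReal_pow, toReal_enorm] at hc'
  -- zero, the mean value of `f`, is the best constant to subtract
  have e2 : ‖f.fn‖ ^ 2 ≤ ‖f.fn - Lp.const 2 Ω.measure c‖ ^ 2 := by
    rw [norm_sub_sq_real, inner_const, hf]
    nlinarith [sq_nonneg ‖(Lp.const 2 Ω.measure c : L2 Ω)‖]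
  rw [inv_mul_le_iff₀ (by positivity)]
  have : 0 ≤ ∑ j, ‖f.grad j‖ ^ 2 := Finset.sum_nonneg fun _ _ => by positivity
  linarith

/-! ### The diffusion form -/

theorem trace_form (D J K : Matrix (Fin 2) (Fin 2) ℝ) :
    (Kᵀ * D * J).trace = ∑ j, (fun i => K i j) ⬝ᵥ (D *ᵥ fun i => J i j) := by
  simp only [Matrix.trace, Matrix.diag, Matrix.mul_assoc]
  rfl

theorem continuous_entry {D : Plane → Matrix (Fin 2) (Fin 2) ℝ} {α L M : ℝ}
    (hD : IsDiffusionMatrix D α L M) (i j : Fin 2) : Continuous fun s => D s i j := by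
  refine (LipschitzWith.of_dist_le_mul (K := L.toNNReal) fun r s => ?_).continuous
  rw [Real.dist_eq, dist_eq_norm, Real.coe_toNNReal _ hD.lip_pos.le]
  exact hD.lipschitz s r i j

theorem aestronglyMeasurable_val (u : X1 Ω) : AEStronglyMeasurable u.val Ω.measure := by
  have h : Measurable fun x => (fun i => (u.comp i).fn x : Fin 2 → ℝ) :=
    measurable_pi_iff.2 fun i => (Lp.stronglyMeasurable (u.comp i).fn).measurable
  exact ((PiLp.continuous_toLp 2 _).measurable.comp h).aestronglyMeasurable

/-- The boundedness of `D` makes the integrand of the diffusion form integrable. -/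
theorem integrable_diffusionForm {D : Plane → Matrix (Fin 2) (Fin 2) ℝ} {α L M : ℝ}
    (hD : IsDiffusionMatrix D α L M) (u w : X1 Ω) :
    Integrable (fun x => ((w.jacobian x)ᵀ * D (u.val x) * u.jacobian x).trace) Ω.measure := by
  simp only [trace_form, dotProduct, Matrix.mulVec, Finset.mul_sum]
  refine integrable_finsetSum _ fun j _ => integrable_finsetSum _ fun i _ =>
    integrable_finsetSum _ fun k _ => ?_
  have h1 : Integrable (fun x => (w.comp i).grad j x * (u.comp k).grad j x) Ω.measure :=
    (Lp.memLp _).integrable_mul (Lp.memLp _)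
  have h2 : Integrable (fun x => D (u.val x) i k * ((w.comp i).grad j x * (u.comp k).grad j x))
      Ω.measure :=
    h1.bdd_mul (c := M) ((continuous_entry hD i k).comp_aestronglyMeasurable
      (aestronglyMeasurable_val u)) (Eventually.of_forall fun x => hD.bounded _ i k)
  refine h2.congr (Eventually.of_forall fun x => ?_)
  simp only [X1.jacobian, Matrix.of_apply]
  ring

theorem norm_L2_sq (g : L2 Ω) : ‖g‖ ^ 2 = ∫ x, g x * g x ∂Ω.measure := by
  rw [← real_inner_self_eq_norm_sq, L2.inner_def]
  rfl

/-- Ellipticity of the diffusion form. -/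
theorem le_diffusionForm {D : Plane → Matrix (Fin 2) (Fin 2) ℝ} {α L M : ℝ}
    (hD : IsDiffusionMatrix D α L M) (u : X1 Ω) :
    α * ∑ i, ∑ j, ‖(u.comp i).grad j‖ ^ 2 ≤ diffusionForm D u u := by
  have hi : ∀ i j, Integrable (fun x => (u.comp i).grad j x * (u.comp i).grad j x) Ω.measure :=
    fun i j => (Lp.memLp _).integrable_mul (Lp.memLp _)
  have e : α * ∑ i, ∑ j, ‖(u.comp i).grad j‖ ^ 2 = ∫ x, α * ∑ j, ∑ i,
      (u.comp i).grad j x * (u.comp i).grad j x ∂Ω.measure := by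
    rw [integral_const_mul, integral_finsetSum _ fun j _ => integrable_finsetSum _
      fun i _ => hi i j,
      Finset.sum_comm]
    congr 1
    refine Finset.sum_congr rfl fun j _ => ?_
    rw [integral_finsetSum _ fun i _ => hi i j]
    exact Finset.sum_congr rfl fun i _ => norm_L2_sq _
  rw [e]
  refine integral_mono ((integrable_finsetSum _ fun j _ => integrable_finsetSum _ fun i _ =>
    hi i j).const_mul α) (integrable_diffusionForm hD u u) fun x => ?_
  simp only [trace_form, Finset.mul_sum]
  refine Finset.sum_le_sum fun j _ => ?_
  rw [← Finset.mul_sum]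
  exact hD.elliptic (u.val x) fun i => u.jacobian x i j

/-- The second argument of the diffusion form only enters through its gradient. -/
theorem diffusionForm_congr (D : Plane → Matrix (Fin 2) (Fin 2) ℝ) (u : X1 Ω) {v w : X1 Ω}
    (h : ∀ i j, (v.comp i).grad j = (w.comp i).grad j) :
    diffusionForm D u v = diffusionForm D u w := by
  have : v.jacobian = w.jacobian := by
    funext x
    ext i j
    simp only [X1.jacobian, Matrix.of_apply, h]
  simp only [diffusionForm, this]

theorem diffusionForm_const (D : Plane → Matrix (Fin 2) (Fin 2) ℝ) (u : X1 Ω) (C : Fin 2 → ℝ) :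
    diffusionForm D u (X1.const Ω C) = 0 := by
  refine integral_eq_zero_of_ae ?_
  filter_upwards [Lp.coeFn_zero ℝ 2 Ω.measure] with x hx
  have : (X1.const Ω C).jacobian x = 0 := by
    ext i j
    simp only [X1.jacobian, Matrix.of_apply, X1.grad_const, hx]
    rfl
  simp [this]

/-! ### Decay of weak solutions -/

/-- A form of **Grönwall's inequality** with a negative rate. -/
theorem le_exp_mul_of_sub_le_integral {N : ℝ → ℝ} (hN : Continuous N) {k : ℝ}
    (h : ∀ a b : ℝ, 0 ≤ a → a ≤ b → N b - N a ≤ -k * ∫ t in a..b, N t) {t : ℝ} (ht : 0 ≤ t) :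
    N t ≤ Real.exp (-k * t) * N 0 := by
  have := le_gronwallBound_of_liminf_deriv_right_le (f := N) (f' := fun s => -k * N s)
    (δ := N 0) (K := -k) (ε := 0) (a := 0) (b := t) hN.continuousOn ?_ le_rfl
    (fun x _ => by simp) t ⟨ht, le_rfl⟩
  · rwa [gronwallBound_ε0, sub_zero, mul_comm] at this
  intro x hx r hr
  have hd := ((hN.integral_hasStrictDerivAt x x).hasDerivAt.const_mul (-k)).hasDerivWithinAt
    (s := Ioi x)
  rw [hasDerivWithinAt_iff_tendsto_slope' self_notMem_Ioi] at hd
  refine Eventually.frequently ?_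
  filter_upwards [hd.eventually (gt_mem_nhds hr), self_mem_nhdsWithin] with z hz hxz
  have hxz' : x < z := hxz
  refine lt_of_le_of_lt ?_ hz
  rw [slope_def_field, intervalIntegral.integral_same, mul_zero, sub_zero, div_eq_inv_mul]
  exact mul_le_mul_of_nonneg_left (h x z hx.1 hxz'.le) (inv_nonneg.2 (sub_pos.2 hxz').le)

variable {Ω : Domain} {D : Plane → Matrix (Fin 2) (Fin 2) ℝ} {u₀ : X0 Ω} {u : ℝ → X0 Ω}

/-- Values at negative times are irrelevant; with this modification `u` is continuous on `ℝ`. -/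
theorem IsWeakSolution.continuous_max (h : IsWeakSolution D u₀ u) :
    Continuous fun t => u (max t 0) :=
  h.continuousOn.comp_continuous (by fun_prop) fun t => mem_Ici.2 (le_max_right t 0)

theorem integrable_apply_of_memLp {T : ℝ} {du : ℝ → StrongDual ℝ (X1 Ω)}
    (hdu : MemLp du 2 (volume.restrict (Ioc 0 T))) (w : X1 Ω) :
    IntegrableOn (fun t => du t w) (Ioc 0 T) :=
  (ContinuousLinearMap.apply ℝ ℝ w).integrable_comp (hdu.integrable (by norm_num))

/-- The weak time derivative is the derivative of an absolutely continuous function. -/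
theorem IsWeakTimeDeriv.inner_sub_eq_integral {T : ℝ} {du : ℝ → StrongDual ℝ (X1 Ω)}
    (hu : Continuous fun t => u (max t 0)) (h : IsWeakTimeDeriv T u du)
    (hdu : MemLp du 2 (volume.restrict (Ioc 0 T))) (w : X1 Ω) {s t : ℝ} (hs : 0 < s) (hst : s ≤ t)
    (ht : t < T) : inner ℝ (u t - u s) w.toX0 = ∫ r in s..t, du r w := by
  have hg : Continuous fun t => inner ℝ (u (max t 0)) w.toX0 := hu.inner continuous_const
  have := sub_eq_integral_of_weak_deriv hg (integrable_apply_of_memLp hdu w)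
    (fun φ h1 h2 h3 => ?_) hs hst ht
  · rw [← this, max_eq_left hs.le, max_eq_left (hs.le.trans hst), inner_sub_left]
  · rw [← h φ h1 h2 h3 w]
    refine setIntegral_congr_fun measurableSet_Ioc fun r hr => ?_
    simp only [max_eq_left hr.1.le]

/-- Conservation of mass: the equation is tested with constants. -/
theorem IsWeakSolution.inner_constant_eq (h : IsWeakSolution D u₀ u) (C : Fin 2 → ℝ) {t : ℝ}
    (ht : 0 ≤ t) : inner ℝ (u t) (constant Ω C) = inner ℝ u₀ (constant Ω C) := by
  rcases ht.eq_or_lt with rfl | ht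
  · rw [h.initial]
  obtain ⟨U, du, -, -, hdu, hder, heq⟩ := h.weak (t + 1) (by linarith)
  -- the time derivative is only tested on the open interval; `s → 0` recovers the initial value
  have hconst : ∀ s ∈ Ioc 0 t, inner ℝ (u t) (constant Ω C) = inner ℝ (u s) (constant Ω C) := by
    intro s hs
    have e := hder.inner_sub_eq_integral h.continuous_max hdu (X1.const Ω C) hs.1 hs.2
      (lt_add_one t)
    have e0 : ∫ r in s..t, du r (X1.const Ω C) = 0 := by
      rw [intervalIntegral.integral_of_le hs.2]
      refine integral_eq_zero_of_ae ?_
      have hsub : Ioc s t ⊆ Ioc 0 (t + 1) := Ioc_subset_Ioc hs.1.le (by linarith)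
      filter_upwards [ae_restrict_of_ae_restrict_of_subset hsub heq] with r hr
      have := hr (X1.const Ω C)
      rwa [diffusionForm_const, add_zero] at this
    rw [e0, X1.toX0_const, inner_sub_left] at e
    linarith
  have hc : Tendsto (fun s => inner ℝ (u (max s 0)) (constant Ω C)) (𝓝[>] 0)
      (𝓝 (inner ℝ (u (max 0 0)) (constant Ω C))) :=
    ((h.continuous_max.inner continuous_const).tendsto 0).mono_left nhdsWithin_le_nhds
  rw [max_self, h.initial] at hc
  refine tendsto_nhds_unique (tendsto_const_nhds.congr' ?_) hc
  filter_upwards [Ioc_mem_nhdsGT ht] with s hs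
  rw [max_eq_left hs.1.le, hconst s hs]

/-- The components of `u(t) - M(u₀)` have mean value zero. -/
theorem IsWeakSolution.integral_sub_average (h : IsWeakSolution D u₀ u) {t : ℝ} (ht : 0 ≤ t)
    (i : Fin 2) : ∫ x, (u t - constant Ω (average u₀)) i x ∂Ω.measure = 0 := by
  have h1 := h.inner_constant_eq (Pi.single i 1) ht
  simp only [inner_constant, Pi.single_apply, ite_mul, one_mul, zero_mul, Finset.sum_ite_eq',
    Finset.mem_univ, if_true] at h1
  have hV := volume_toReal_pos Ω
  rw [integral_sub_constant, h1, average]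
  field_simp
  ring

/-- The energy estimate: the dissipation of the energy is bounded below by ellipticity and the
Poincaré inequality. -/
theorem IsWeakSolution.energy_le {α L M C₀ : ℝ} (hD : IsDiffusionMatrix D α L M)
    (hC₀ : ∀ f : H1 Ω, ∫ x, f.fn x ∂Ω.measure = 0 → C₀ * ‖f.fn‖ ^ 2 ≤ ∑ j, ‖f.grad j‖ ^ 2)
    (h : IsWeakSolution D u₀ u) {a b : ℝ} (ha : 0 ≤ a) (hab : a ≤ b) :
    ‖u b - constant Ω (average u₀)‖ ^ 2 - ‖u a - constant Ω (average u₀)‖ ^ 2 ≤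
      -(2 * α * C₀) * ∫ t in a..b, ‖u t - constant Ω (average u₀)‖ ^ 2 := by
  obtain ⟨U, du, hU, hUu, hdu, hder, heq⟩ := h.weak (b + 1) (by linarith)
  have hm0 : ∀ t, 0 ≤ t → ∀ i, ∫ x, (u t - constant Ω (average u₀)) i x ∂Ω.measure = 0 :=
    fun t ht i => h.integral_sub_average ht i
  generalize average u₀ = m at *
  have hV : MemLp (fun t => U t - X1.const Ω m) 2 (volume.restrict (Ioc 0 (b + 1))) :=
    hU.sub (memLp_const _)
  have hVu : ∀ᵐ t ∂(volume.restrict (Ioc 0 (b + 1))),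
      X1.toX0L Ω (U t - X1.const Ω m) = u (max t 0) - constant Ω m := by
    filter_upwards [hUu, ae_restrict_mem measurableSet_Ioc] with t ht1 ht2
    rw [max_eq_left ht2.1.le, ← ht1]
    rfl
  have hvc : Continuous fun t => u (max t 0) - constant Ω m := h.continuous_max.sub continuous_const
  -- subtracting a constant changes neither the time derivative nor the gradient
  have hid := energy_identity (ι := X1.toX0L Ω) (T := b + 1) hvc hV hdu hVu
    (fun w s t hs hst ht => by
      rw [sub_sub_sub_cancel_right, max_eq_left hs.le, max_eq_left (hs.le.trans hst)]
      exact hder.inner_sub_eq_integral h.continuous_max hdu w hs hst ht) ha hab (lt_add_one b)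
  rw [max_eq_left ha, max_eq_left (ha.trans hab)] at hid
  have hsub : Ioc a b ⊆ Ioc 0 (b + 1) := Ioc_subset_Ioc ha (by linarith)
  have hpt : ∀ᵐ t ∂(volume.restrict (Ioc 0 (b + 1))),
      du t (U t - X1.const Ω m) ≤ -(α * C₀) * ‖u (max t 0) - constant Ω m‖ ^ 2 := by
    filter_upwards [hVu, heq, ae_restrict_mem measurableSet_Ioc] with t ht1 ht2 ht3
    have e1 := ht2 (U t - X1.const Ω m)
    have hgrad : ∀ i j, ((U t - X1.const Ω m).comp i).grad j = ((U t).comp i).grad j := by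
      intro i j
      rw [X1.grad_sub, X1.grad_const, sub_zero]
    rw [diffusionForm_congr D (U t) hgrad] at e1
    have e2 := le_diffusionForm hD (U t)
    have e3 : C₀ * ‖u (max t 0) - constant Ω m‖ ^ 2 ≤
        ∑ i, ∑ j, ‖((U t).comp i).grad j‖ ^ 2 := by
      rw [PiLp.norm_sq_eq_of_L2, Finset.mul_sum]
      refine Finset.sum_le_sum fun i _ => ?_
      have e4 := hC₀ ((U t - X1.const Ω m).comp i)
      have e5 : ((U t - X1.const Ω m).comp i).fn = (u (max t 0) - constant Ω m) i := by
        rw [← ht1]; rfl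
      rw [e5] at e4
      simpa only [hgrad] using e4 (hm0 _ (le_max_right _ _) i)
    have e6 := mul_le_mul_of_nonneg_left e3 hD.alpha_pos.le
    linarith
  have hint : ∫ t in a..b, du t (U t - X1.const Ω m) ≤
      ∫ t in a..b, -(α * C₀) * ‖u (max t 0) - constant Ω m‖ ^ 2 := by
    rw [intervalIntegral.integral_of_le hab, intervalIntegral.integral_of_le hab]
    refine integral_mono_ae ((integrable_pairing hdu hV).mono_measure
      (Measure.restrict_mono_set _ hsub)) ?_ (ae_restrict_of_ae_restrict_of_subset hsub hpt)
    exact ((hvc.norm.pow 2).const_mul _).integrableOn_Ioc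
  have hN : ∫ t in a..b, ‖u (max t 0) - constant Ω m‖ ^ 2 =
      ∫ t in a..b, ‖u t - constant Ω m‖ ^ 2 := by
    refine intervalIntegral.integral_congr fun t ht => ?_
    rw [uIcc_of_le hab] at ht
    simp only [max_eq_left (ha.trans ht.1)]
  rw [intervalIntegral.integral_const_mul, hN] at hint
  rw [hid]
  linarith

/-- Exponential decay at the rate given by ellipticity and the Poincaré constant. -/
theorem IsWeakSolution.norm_sq_le {α L M C₀ : ℝ} (hD : IsDiffusionMatrix D α L M)
    (hC₀ : ∀ f : H1 Ω, ∫ x, f.fn x ∂Ω.measure = 0 → C₀ * ‖f.fn‖ ^ 2 ≤ ∑ j, ‖f.grad j‖ ^ 2)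
    (h : IsWeakSolution D u₀ u) {t : ℝ} (ht : 0 ≤ t) :
    ‖u t - constant Ω (average u₀)‖ ^ 2 ≤
      Real.exp (-2 * α * C₀ * t) * ‖u 0 - constant Ω (average u₀)‖ ^ 2 := by
  have hvc : Continuous fun t => ‖u (max t 0) - constant Ω (average u₀)‖ ^ 2 :=
    (h.continuous_max.sub continuous_const).norm.pow 2
  have := le_exp_mul_of_sub_le_integral hvc (k := 2 * α * C₀) (fun a b ha hab => ?_) ht
  · rw [max_eq_left ht, max_self] at this
    convert this using 3
    ring
  · rw [max_eq_left ha, max_eq_left (ha.trans hab)]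
    refine (h.energy_le hD hC₀ ha hab).trans_eq ?_
    congr 1
    refine intervalIntegral.integral_congr fun t ht => ?_
    rw [uIcc_of_le hab] at ht
    simp only [max_eq_left (ha.trans ht.1)]

end CrossDiffusion

theorem lemma7 (Ω : CrossDiffusion.Domain) :
    ∃ C₀ : ℝ, 0 < C₀ ∧
      ∀ (D : CrossDiffusion.Plane → Matrix (Fin 2) (Fin 2) ℝ) (α L M : ℝ),
        CrossDiffusion.IsDiffusionMatrix D α L M →
        CrossDiffusion.ShiftInvariant Ω D →
        ∀ (u₀ : CrossDiffusion.X0 Ω) (u : ℝ → CrossDiffusion.X0 Ω),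
          CrossDiffusion.IsWeakSolution D u₀ u →
          Filter.Tendsto
              (fun t => ‖u t - CrossDiffusion.constant Ω (CrossDiffusion.average u₀)‖)
              Filter.atTop (nhds 0) ∧
            ∀ t : ℝ, 0 ≤ t →
              ‖u t - CrossDiffusion.constant Ω (CrossDiffusion.average u₀)‖ ^ 2 ≤
                Real.exp (-2 * α * C₀ * t) *
                  ‖u 0 - CrossDiffusion.constant Ω (CrossDiffusion.average u₀)‖ ^ 2 := by
  obtain ⟨C₀, hC₀, hP⟩ := CrossDiffusion.exists_poincare_constant Ω
  refine ⟨C₀, hC₀, fun D α L M hD _ u₀ u h => ?_⟩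
  refine ⟨?_, fun t ht => h.norm_sq_le hD hP ht⟩
  have hrate : -2 * α * C₀ < 0 := by nlinarith [mul_pos hD.alpha_pos hC₀]
  have hexp : Filter.Tendsto (fun t : ℝ => Real.exp (-2 * α * C₀ * t)) Filter.atTop (nhds 0) :=
    Real.tendsto_exp_atBot.comp (Filter.tendsto_id.const_mul_atTop_of_neg hrate)
  have hbound := hexp.mul_const
    (‖u 0 - CrossDiffusion.constant Ω (CrossDiffusion.average u₀)‖ ^ 2)
  rw [zero_mul] at hbound
  have hsq : Filter.Tendsto
      (fun t => ‖u t - CrossDiffusion.constant Ω (CrossDiffusion.average u₀)‖ ^ 2)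
      Filter.atTop (nhds 0) := by
    refine squeeze_zero' (Filter.Eventually.of_forall fun t => by positivity) ?_ hbound
    filter_upwards [Filter.eventually_ge_atTop 0] with t ht
    exact h.norm_sq_le hD hP ht
  simpa using hsq.sqrt
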